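/- Let $n\ge 1$ and $\lambda_1,\dots,\lambda_n>0$. On $H_{n+1}=\mathbb C^n\times\mathbb R$, with points $x=(z,x_{2n+1})$, $y=(w,y_{2n+1})$ and $z_j=x_{2j-1}+ix_{2j}$, consider the CR structure $T^{1,0}H_{n+1}$ spanned by $Z_j=\frac{\partial}{\partial z_j}-i\lambda_j\overline z_j\frac{\partial}{\partial x_{2n+1}}$, $j=1,\dots,n$. Let $d\mu=2^n\,dx_1\cdots dx_{2n+1}$, the volume of the Hermitian metric for which $Z_j,\overline Z_j$ $(1\le j\le n)$ and $\frac{\partial}{\partial x_{2n+1}}$ are orthonormal, and let $L^2(H_{n+1})$ and $L^2_{(0,1)}(H_{n+1})$ be the corresponding $L^2$ spaces of functions and of $(0,1)$-forms $\sum_j v_j\,d\overline z_j$, with $\|\sum_j v_j\,d\overline z_j\|^2=\sum_j\int|v_j|^2\,d\mu$. Let $\overline\partial_b u=\sum_j(\overline Z_ju)\,d\overline z_j$ in the sense of distributions, with domain the set of all $u\in L^2(H_{n+1})$ such that $\overline\partial_bu\in L^2_{(0,1)}(H_{n+1})$, let $\overline\partial_b^{*}$ be its Hilbert space adjoint, and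 let $\Box_b^{(0)}=\overline\partial_b^{*}\overline\partial_b$ with domain $\{u\in\operatorname{Dom}\overline\partial_b:\overline\partial_bu\in\operatorname{Dom}\overline\partial_b^{*}\}$. The Szegő projection $S^{(0)}:L^2(H_{n+1})\to\operatorname{Ker}\Box_b^{(0)}$ is the orthogonal projection onto $\operatorname{Ker}\Box_b^{(0)}$. Put $$\varphi_-(x,y)=-x_{2n+1}+y_{2n+1}+i\sum_{j=1}^n|\lambda_j||z_j-w_j|^2+i\sum_{j=1}^n\lambda_j(\overline z_jw_j-z_j\overline w_j).$$ Then, for every $u\in C_c^\infty(H_{n+1})$ and every $x\in H_{n+1}$, the limit $$(I^{(0)}_{\varphi_-}u)(x)=\lim_{\varepsilon\to0^+}\int_{H_{n+1}}\frac{u(y)}{\bigl(-i(\varphi_-(x,y)+i\varepsilon)\bigr)^{n+1}}\,d\mu(y)$$ exists, the operator $I^{(0)}_{\varphi_-}$ extends uniquely to a bounded operator on $L^2(H_{n+1})$, and, writing $I^{(0)}_{\varphi_-}$ also for this extension, $$S^{(0)}=\frac{|\lambda_1|\cdots|\lambda_n|}{2\pi^{n+1}}\,n!\;I^{(0)}_{\varphi_-}\quad\text{on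 }L^2(H_{n+1}).$$ -/

import Mathlib

open MeasureTheory Filter Topology
open scoped NNReal ENNReal ContDiff ComplexConjugate InnerProductSpace

noncomputable section

namespace Heisenberg

/-- The space `ℂⁿ × ℝ` with coordinates `x = (z, t)`, `t = x_{2n+1}`. -/
abbrev Heis (n : ℕ) : Type := (Fin n → ℂ) × ℝ

/-- The volume `2ⁿ dx₁ ⋯ dx_{2n+1}`, induced by the metric in which `Z_j, Z̄_j, T` are orthonormal. -/
abbrev heisVol (n : ℕ) : Measure (Heis n) := (2 ^ n : ℝ≥0) • (volume : Measure (Heis n))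

/-- `L²(H_{n+1})`. -/
abbrev L2Fun (n : ℕ) : Type := Lp ℂ 2 (heisVol n)

/-- `L²_{(0,1)}(H_{n+1})`; a `(0,1)`-form `∑ v_j dz̄_j` is given by its coefficients `v_j` in the
orthonormal frame `dz̄_1, …, dz̄_n`. -/
abbrev L2Form (n : ℕ) : Type := Lp (EuclideanSpace ℂ (Fin n)) 2 (heisVol n)

/-- `u ∈ C_c^∞(H_{n+1})`. -/
def IsTest {n : ℕ} (u : Heis n → ℂ) : Prop := ContDiff ℝ ∞ u ∧ HasCompactSupport u

/-- `∂f/∂z̄_j = ½ (∂f/∂x_{2j-1} + i ∂f/∂x_{2j})`. -/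
def dzbar {n : ℕ} (j : Fin n) (f : Heis n → ℂ) (x : Heis n) : ℂ :=
  (1 / 2) * (fderiv ℝ f x (Pi.single j 1, 0) + Complex.I * fderiv ℝ f x (Pi.single j Complex.I, 0))

/-- `∂f/∂x_{2n+1}`. -/
def dt {n : ℕ} (f : Heis n → ℂ) (x : Heis n) : ℂ := fderiv ℝ f x (0, 1)

/-- The vector field `Z̄_j = ∂/∂z̄_j + i λ_j z_j ∂/∂x_{2n+1}`. -/
def Zbar {n : ℕ} (lam : Fin n → ℝ) (j : Fin n) (f : Heis n → ℂ) (x : Heis n) : ℂ :=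
  dzbar j f x + Complex.I * lam j * x.1 j * dt f x

/-- `∂̄_b u = ∑ v_j dz̄_j` in the sense of distributions, i.e. `Z̄_j u = v_j` weakly for all `j`.
The coefficient of `∂/∂x_{2n+1}` in `Z̄_j` does not depend on `x_{2n+1}`, so the transpose of `Z̄_j`
is `-Z̄_j`. -/
def IsWeakDbar {n : ℕ} (lam : Fin n → ℝ) (u : Heis n → ℂ)
    (v : Heis n → EuclideanSpace ℂ (Fin n)) : Prop :=
  ∀ (j : Fin n) (φ : Heis n → ℂ), IsTest φ →
    ∫ x, v x j * φ x ∂(heisVol n) = -∫ x, u x * Zbar lam j φ x ∂(heisVol n)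

section helpers

variable {n : ℕ}

theorem IsTest.memLp {u : Heis n → ℂ} (hu : IsTest u) : MemLp u 2 (heisVol n) :=
  hu.1.continuous.memLp_of_hasCompactSupport hu.2

theorem IsTest.fderiv_apply {u : Heis n → ℂ} (hu : IsTest u) (e : Heis n) :
    IsTest (fun x => fderiv ℝ u x e) :=
  ⟨(hu.1.fderiv_right (by simp)).clm_apply contDiff_const, hu.2.fderiv_apply (𝕜 := ℝ) e⟩

theorem contDiff_coord (j : Fin n) : ContDiff ℝ ∞ (fun x : Heis n => x.1 j) :=
  (contDiff_apply ℝ ℂ j).comp contDiff_fst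

theorem IsTest.mul_left {u : Heis n → ℂ} (hu : IsTest u) {g : Heis n → ℂ} (hg : ContDiff ℝ ∞ g) :
    IsTest (fun x => g x * u x) :=
  ⟨hg.mul hu.1, hu.2.mul_left⟩

theorem IsTest.add {u v : Heis n → ℂ} (hu : IsTest u) (hv : IsTest v) :
    IsTest (fun x => u x + v x) :=
  ⟨hu.1.add hv.1, hu.2.add hv.2⟩

theorem IsTest.zbar {u : Heis n → ℂ} (hu : IsTest u) (lam : Fin n → ℝ) (j : Fin n) :
    IsTest (Zbar lam j u) :=
  (((hu.fderiv_apply _).add ((hu.fderiv_apply _).mul_left contDiff_const)).mul_left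
    contDiff_const).add
    ((hu.fderiv_apply _).mul_left ((contDiff_const.mul contDiff_const).mul (contDiff_coord j)))

theorem integrable_mul_test {u φ : Heis n → ℂ} (hu : MemLp u 2 (heisVol n)) (hφ : IsTest φ) :
    Integrable (fun x => u x * φ x) (heisVol n) :=
  hu.integrable_mul hφ.memLp

theorem memLp_coord {v : Heis n → EuclideanSpace ℂ (Fin n)} (hv : MemLp v 2 (heisVol n))
    (j : Fin n) : MemLp (fun x => v x j) 2 (heisVol n) :=
  (EuclideanSpace.proj (𝕜 := ℂ) j).comp_memLp' hv

theorem integral_fderiv_mul {u φ : Heis n → ℂ} (hu : IsTest u) (hφ : IsTest φ) (e : Heis n) :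
    ∫ x, fderiv ℝ u x e * φ x ∂(heisVol n) = -∫ x, u x * fderiv ℝ φ x e ∂(heisVol n) := by
  have hint : ∀ {f g : Heis n → ℂ}, IsTest f → IsTest g →
      Integrable (fun x => f x * g x) (volume : Measure (Heis n)) := fun hf hg =>
    (hf.1.continuous.mul hg.1.continuous).integrable_of_hasCompactSupport hg.2.mul_left
  have : (volume : Measure (Fin n → ℂ)).IsAddHaarMeasure := Measure.pi.isAddHaarMeasure _
  have : (volume : Measure (Heis n)).IsAddHaarMeasure :=
    inferInstanceAs (((volume : Measure (Fin n → ℂ)).prod (volume : Measure ℝ)).IsAddHaarMeasure)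
  have h := integral_mul_fderiv_eq_neg_fderiv_mul_of_integrable (v := e)
    (μ := (volume : Measure (Heis n))) (hint (hu.fderiv_apply e) hφ) (hint hu (hφ.fderiv_apply e))
    (hint hu hφ) (fun x _ => (hu.1.differentiable (by simp)).differentiableAt)
    (fun x _ => (hφ.1.differentiable (by simp)).differentiableAt)
  rw [integral_smul_nnreal_measure, integral_smul_nnreal_measure, h, smul_neg, neg_neg]

theorem dt_coord_mul {φ : Heis n → ℂ} (hφ : IsTest φ) (j : Fin n) (x : Heis n) :
    fderiv ℝ (fun y : Heis n => y.1 j * φ y) x (0, 1) = x.1 j * fderiv ℝ φ x (0, 1) := by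
  let L : Heis n →L[ℝ] ℂ :=
    (ContinuousLinearMap.proj (R := ℝ) (φ := fun _ : Fin n => ℂ) j).comp
      (ContinuousLinearMap.fst ℝ (Fin n → ℂ) ℝ)
  have h := (L.hasFDerivAt (x := x)).mul
    ((hφ.1.differentiable (by simp)).differentiableAt (x := x)).hasFDerivAt
  have h2 : fderiv ℝ (fun y : Heis n => y.1 j * φ y) x = _ := h.fderiv
  rw [h2]
  simp [L]

/-- For test functions the pointwise `Z̄_j u` is the distributional one. -/
theorem integral_zbar_mul (lam : Fin n → ℝ) (j : Fin n) {u φ : Heis n → ℂ} (hu : IsTest u)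
    (hφ : IsTest φ) :
    ∫ x, Zbar lam j u x * φ x ∂(heisVol n) = -∫ x, u x * Zbar lam j φ x ∂(heisVol n) := by
  have h1 := integral_fderiv_mul hu hφ (Pi.single j 1, 0)
  have h2 := integral_fderiv_mul hu hφ (Pi.single j Complex.I, 0)
  have h3 := integral_fderiv_mul hu (hφ.mul_left (contDiff_coord j)) (0, 1)
  simp only [dt_coord_mul hφ] at h3
  have i1 : ∀ e, Integrable (fun x => fderiv ℝ u x e * φ x) (heisVol n) := fun e =>
    integrable_mul_test (hu.fderiv_apply e).memLp hφ
  have i2 : ∀ e, Integrable (fun x => u x * fderiv ℝ φ x e) (heisVol n) := fun e =>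
    integrable_mul_test hu.memLp (hφ.fderiv_apply e)
  have i3 : Integrable (fun x => fderiv ℝ u x (0, 1) * (x.1 j * φ x)) (heisVol n) :=
    integrable_mul_test (hu.fderiv_apply _).memLp (hφ.mul_left (contDiff_coord j))
  have i4 : Integrable (fun x => u x * (x.1 j * fderiv ℝ φ x (0, 1))) (heisVol n) :=
    integrable_mul_test hu.memLp ((hφ.fderiv_apply _).mul_left (contDiff_coord j))
  have e1 : ∀ x, Zbar lam j u x * φ x =
      (1 / 2) * (fderiv ℝ u x (Pi.single j 1, 0) * φ x)
        + (1 / 2 * Complex.I) * (fderiv ℝ u x (Pi.single j Complex.I, 0) * φ x)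
        + (Complex.I * lam j) * (fderiv ℝ u x (0, 1) * (x.1 j * φ x)) := by
    intro x; simp only [Zbar, dzbar, dt]; ring
  have e2 : ∀ x, u x * Zbar lam j φ x =
      (1 / 2) * (u x * fderiv ℝ φ x (Pi.single j 1, 0))
        + (1 / 2 * Complex.I) * (u x * fderiv ℝ φ x (Pi.single j Complex.I, 0))
        + (Complex.I * lam j) * (u x * (x.1 j * fderiv ℝ φ x (0, 1))) := by
    intro x; simp only [Zbar, dzbar, dt]; ring
  simp only [e1, e2]
  have key : ∀ {f g h : Heis n → ℂ} (a b c : ℂ), Integrable f (heisVol n) →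
      Integrable g (heisVol n) → Integrable h (heisVol n) →
      ∫ x, (a * f x + b * g x + c * h x) ∂(heisVol n) =
        a * ∫ x, f x ∂(heisVol n) + b * ∫ x, g x ∂(heisVol n) + c * ∫ x, h x ∂(heisVol n) := by
    intro f g h a b c hf hg hh
    have s1 : Integrable (fun x => a * f x + b * g x) (heisVol n) :=
      (hf.const_mul a).add (hg.const_mul b)
    rw [integral_add s1 (hh.const_mul c), integral_add (hf.const_mul a) (hg.const_mul b)]
    simp only [integral_const_mul]
  rw [key _ _ _ (i1 _) (i1 _) i3, key _ _ _ (i2 _) (i2 _) i4, h1, h2, h3]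
  ring

theorem isWeakDbar_congr (lam : Fin n → ℝ) {u u' : Heis n → ℂ}
    {v v' : Heis n → EuclideanSpace ℂ (Fin n)} (hu : u =ᵐ[heisVol n] u')
    (hv : v =ᵐ[heisVol n] v') (h : IsWeakDbar lam u v) : IsWeakDbar lam u' v' := by
  intro j φ hφ
  have a := h j φ hφ
  have e1 : ∫ x, v x j * φ x ∂(heisVol n) = ∫ x, v' x j * φ x ∂(heisVol n) :=
    integral_congr_ae (hv.mono fun x hx => by simp only [hx])
  have e2 : ∫ x, u x * Zbar lam j φ x ∂(heisVol n) = ∫ x, u' x * Zbar lam j φ x ∂(heisVol n) :=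
    integral_congr_ae (hu.mono fun x hx => by simp only [hx])
  rw [← e1, ← e2, a]

end helpers

/-- The graph of `∂̄_b : Dom ∂̄_b ⊂ L²(H_{n+1}) → L²_{(0,1)}(H_{n+1})`. -/
def dbarGraph {n : ℕ} (lam : Fin n → ℝ) : Submodule ℂ (L2Fun n × L2Form n) where
  carrier := {p | IsWeakDbar lam p.1 p.2}
  zero_mem' := by
    refine isWeakDbar_congr lam (Lp.coeFn_zero _ _ _).symm (Lp.coeFn_zero _ _ _).symm ?_
    intro j φ _
    simp
  add_mem' := by
    intro p q hp hq
    refine isWeakDbar_congr lam (Lp.coeFn_add p.1 q.1).symm (Lp.coeFn_add p.2 q.2).symm ?_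
    intro j φ hφ
    have a := hp j φ hφ
    have b := hq j φ hφ
    simp only [Pi.add_apply, PiLp.add_apply, add_mul]
    rw [integral_add (integrable_mul_test (memLp_coord (Lp.memLp p.2) j) hφ)
        (integrable_mul_test (memLp_coord (Lp.memLp q.2) j) hφ),
      integral_add (integrable_mul_test (Lp.memLp p.1) (hφ.zbar lam j))
        (integrable_mul_test (Lp.memLp q.1) (hφ.zbar lam j)), a, b]
    ring
  smul_mem' := by
    intro c p hp
    refine isWeakDbar_congr lam (Lp.coeFn_smul c p.1).symm (Lp.coeFn_smul c p.2).symm ?_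
    intro j φ hφ
    have a := hp j φ hφ
    simp only [Pi.smul_apply, PiLp.smul_apply, smul_eq_mul, mul_assoc, integral_const_mul, a,
      mul_neg]

theorem mem_dbarGraph {n : ℕ} {lam : Fin n → ℝ} {p : L2Fun n × L2Form n} :
    p ∈ dbarGraph lam ↔ IsWeakDbar lam p.1 p.2 := Iff.rfl

/-- `∂̄_b u` is determined by `u`. -/
theorem dbarGraph_functional {n : ℕ} (lam : Fin n → ℝ) (p : L2Fun n × L2Form n)
    (hp : p ∈ dbarGraph lam) (h0 : p.1 = 0) : p.2 = 0 := by
  obtain ⟨u, v⟩ := p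
  simp only at h0
  subst h0
  have hw : IsWeakDbar lam 0 v := isWeakDbar_congr lam (Lp.coeFn_zero _ _ _) (ae_eq_refl _) hp
  have hj : ∀ j, ∀ᵐ x ∂(heisVol n), v x j = 0 := by
    intro j
    refine ae_eq_zero_of_integral_contDiff_smul_eq_zero
      ((memLp_coord (Lp.memLp v) j).locallyIntegrable (by norm_num)) ?_
    intro g hg hg'
    have ht : IsTest (fun x => (g x : ℂ)) :=
      ⟨Complex.ofRealCLM.contDiff.comp hg, hg'.comp_left (g := fun r : ℝ => (r : ℂ)) (by simp)⟩
    have := hw j _ ht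
    simp only [Pi.zero_apply, zero_mul, integral_zero, neg_zero] at this
    rw [← this]
    refine integral_congr_ae (ae_of_all _ fun x => ?_)
    simp [Complex.real_smul, mul_comm]
  refine Lp.ext ?_
  filter_upwards [ae_all_iff.2 hj, Lp.coeFn_zero (EuclideanSpace ℂ (Fin n)) 2 (heisVol n)]
    with x hx h0
  rw [h0]
  ext j
  exact hx j

/-- `∂̄_b` on functions: the domain is the set of all `u ∈ L²` whose distributional `∂̄_b u` is in
`L²_{(0,1)}`. -/
def dbarB {n : ℕ} (lam : Fin n → ℝ) : L2Fun n →ₗ.[ℂ] L2Form n := (dbarGraph lam).toLinearPMap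

/-- The composition of unbounded operators, on its natural domain
`{s ∈ Dom f | f s ∈ Dom g}`. -/
def compPMap {E F G : Type*} [AddCommGroup E] [Module ℂ E] [AddCommGroup F] [Module ℂ F]
    [AddCommGroup G] [Module ℂ G] (g : F →ₗ.[ℂ] G) (f : E →ₗ.[ℂ] F) : E →ₗ.[ℂ] G where
  domain := (g.domain.comap f.toFun).map f.domain.subtype
  toFun := g.toFun ∘ₗ (f.toFun.restrict (p := g.domain.comap f.toFun) (q := g.domain)
      fun _ h => h) ∘ₗ
    (Submodule.equivMapOfInjective f.domain.subtype f.domain.injective_subtype _).symm.toLinearMap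

/-- The Kohn Laplacian `□_b^{(0)} = ∂̄_b^* ∂̄_b` (Gaffney extension) on functions. On functions
`∂̄_b^*` is the zero map on all of `L²(H_{n+1})`, so the conditions `s ∈ Dom ∂̄_b^*`,
`∂̄_b^* s ∈ Dom ∂̄_b` and the term `∂̄_b ∂̄_b^* s` are void. -/
def kohnLaplacian {n : ℕ} (lam : Fin n → ℝ) : L2Fun n →ₗ.[ℂ] L2Fun n :=
  compPMap (dbarB lam).adjoint (dbarB lam)

/-- `ℋ_b^0(H_{n+1}) = Ker □_b^{(0)}`. -/
def kerKohn {n : ℕ} (lam : Fin n → ℝ) : Submodule ℂ (L2Fun n) :=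
  (LinearMap.ker (kohnLaplacian lam).toFun).map (kohnLaplacian lam).domain.subtype

theorem mem_kerKohn {n : ℕ} {lam : Fin n → ℝ} {u : L2Fun n} :
    u ∈ kerKohn lam ↔ ∃ (hu : u ∈ (dbarB lam).domain)
      (hv : dbarB lam ⟨u, hu⟩ ∈ (dbarB lam).adjoint.domain),
        (dbarB lam).adjoint ⟨dbarB lam ⟨u, hu⟩, hv⟩ = 0 := by
  have key : ∀ (hu : u ∈ (dbarB lam).domain)
      (hv : dbarB lam ⟨u, hu⟩ ∈ (dbarB lam).adjoint.domain)
      (hw : u ∈ (kohnLaplacian lam).domain),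
      (kohnLaplacian lam).toFun ⟨u, hw⟩ =
        (dbarB lam).adjoint ⟨dbarB lam ⟨u, hu⟩, hv⟩ := by
    intro hu hv hw
    have e : (Submodule.equivMapOfInjective (dbarB lam).domain.subtype
        (dbarB lam).domain.injective_subtype
        ((dbarB lam).adjoint.domain.comap (dbarB lam).toFun)).symm ⟨u, hw⟩ = ⟨⟨u, hu⟩, hv⟩ := by
      rw [LinearEquiv.symm_apply_eq]
      rfl
    change (dbarB lam).adjoint.toFun (((dbarB lam).toFun.restrict fun _ h => h)
      ((Submodule.equivMapOfInjective (dbarB lam).domain.subtype _ _).symm ⟨u, hw⟩)) = _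
    rw [e]
    rfl
  constructor
  · rintro ⟨⟨_, hw⟩, h0, rfl⟩
    obtain ⟨⟨y, hy⟩, hy', rfl⟩ := id hw
    exact ⟨hy, hy', (key hy hy' hw).symm.trans h0⟩
  · rintro ⟨hu, hv, h0⟩
    have hw : u ∈ (kohnLaplacian lam).domain := ⟨⟨u, hu⟩, hv, rfl⟩
    exact ⟨⟨u, hw⟩, (key hu hv hw).trans h0, rfl⟩

theorem dense_dbarB_domain {n : ℕ} (lam : Fin n → ℝ) :
    Dense ((dbarB lam).domain : Set (L2Fun n)) := by
  refine (Lp.dense_hasCompactSupport_contDiff (F := ℂ) (μ := heisVol n) (p := 2)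
    (by norm_num)).mono ?_
  rintro f ⟨g, hfg, hg1, hg2⟩
  have hg : IsTest g := ⟨hg2, hg1⟩
  let w : Heis n → EuclideanSpace ℂ (Fin n) := fun x => WithLp.toLp 2 fun j => Zbar lam j g x
  have hw : MemLp w 2 (heisVol n) := by
    refine Continuous.memLp_of_hasCompactSupport
      ((PiLp.continuous_toLp 2 _).comp
        (continuous_pi fun j => (hg.zbar lam j).1.continuous)) ?_
    refine HasCompactSupport.intro' (K := tsupport g) hg.2 (isClosed_tsupport g) fun x hx => ?_
    have h0 : fderiv ℝ g x = 0 := by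
      have := (support_fderiv_subset ℝ (f := g)).trans (le_refl _)
      by_contra h
      exact hx (this h)
    ext j
    simp [w, Zbar, dzbar, dt, h0]
  refine ⟨(f, hw.toLp w), ?_, rfl⟩
  refine isWeakDbar_congr lam hfg.symm hw.coeFn_toLp.symm ?_
  intro j φ hφ
  exact integral_zbar_mul lam j hg hφ

/-- `Ker □_b^{(0)} = Ker ∂̄_b`. -/
theorem mem_kerKohn_iff {n : ℕ} {lam : Fin n → ℝ} {u : L2Fun n} :
    u ∈ kerKohn lam ↔ IsWeakDbar lam u (fun _ => 0) := by
  have hz : IsWeakDbar lam u (fun _ => 0) ↔ (u, (0 : L2Form n)) ∈ dbarGraph lam :=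
    ⟨isWeakDbar_congr lam (ae_eq_refl _) (Lp.coeFn_zero _ _ _).symm,
      isWeakDbar_congr lam (ae_eq_refl _) (Lp.coeFn_zero _ _ _)⟩
  rw [hz, mem_kerKohn]
  have hgr := Submodule.toLinearPMap_graph_eq (dbarGraph lam) (dbarGraph_functional lam)
  constructor
  · rintro ⟨hu, hv, h0⟩
    have h := LinearPMap.adjoint_isFormalAdjoint (dense_dbarB_domain lam)
      ⟨dbarB lam ⟨u, hu⟩, hv⟩ ⟨u, hu⟩
    rw [h0, inner_zero_left] at h
    have h1 : dbarB lam ⟨u, hu⟩ = 0 := inner_self_eq_zero.1 h.symm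
    have h2 := LinearPMap.mem_graph (dbarB lam) ⟨u, hu⟩
    rw [h1] at h2
    exact hgr ▸ h2
  · intro h
    have h' : (u, (0 : L2Form n)) ∈ (dbarB lam).graph := by
      rw [dbarB, hgr]
      exact h
    obtain ⟨⟨y, hy⟩, hy1, hy2⟩ := (LinearPMap.mem_graph_iff _).1 h'
    simp only at hy1 hy2
    subst hy1
    have hv : dbarB lam ⟨y, hy⟩ ∈ (dbarB lam).adjoint.domain := by
      rw [hy2]
      exact Submodule.zero_mem _
    refine ⟨hy, hv, ?_⟩
    have : (⟨dbarB lam ⟨y, hy⟩, hv⟩ : (dbarB lam).adjoint.domain) = 0 := Subtype.ext hy2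
    rw [this, LinearPMap.map_zero]

theorem isClosed_kerKohn {n : ℕ} (lam : Fin n → ℝ) : IsClosed (kerKohn lam : Set (L2Fun n)) := by
  have hconj : ∀ {φ : Heis n → ℂ}, IsTest φ → IsTest (fun x => conj (φ x)) := fun hφ =>
    ⟨Complex.conjCLE.contDiff.comp hφ.1, hφ.2.comp_left (g := fun c : ℂ => conj c) (by simp)⟩
  have hset : (kerKohn lam : Set (L2Fun n)) = ⋂ (j : Fin n) (φ : {φ : Heis n → ℂ // IsTest φ}),
      {u | ⟪(hconj (φ.2.zbar lam j)).memLp.toLp _, u⟫_ℂ = 0} := by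
    ext u
    simp only [SetLike.mem_coe, mem_kerKohn_iff, IsWeakDbar, Set.mem_iInter, Subtype.forall,
      Set.mem_ofPred_eq]
    refine forall_congr' fun j => forall_congr' fun φ => forall_congr' fun hφ => ?_
    have e : ⟪(hconj (hφ.zbar lam j)).memLp.toLp _, u⟫_ℂ =
        ∫ x, u x * Zbar lam j φ x ∂(heisVol n) := by
      rw [L2.inner_def]
      refine integral_congr_ae ?_
      filter_upwards [(hconj (hφ.zbar lam j)).memLp.coeFn_toLp] with x hx
      rw [hx]
      simp [RCLike.inner_apply]
    rw [e]
    simp [eq_comm]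
  rw [hset]
  exact isClosed_iInter fun j => isClosed_iInter fun φ =>
    isClosed_eq (continuous_const.inner continuous_id) continuous_const

instance instHasOrthogonalProjectionKerKohn {n : ℕ} (lam : Fin n → ℝ) : (kerKohn lam).HasOrthogonalProjection :=
  haveI : CompleteSpace (kerKohn lam) := (isClosed_kerKohn lam).completeSpace_coe
  inferInstance

/-- The Szegő projection `S^{(0)}`: the orthogonal projection of `L²(H_{n+1})` onto
`Ker □_b^{(0)}`. -/
def szegoProjection {n : ℕ} (lam : Fin n → ℝ) : L2Fun n →L[ℂ] L2Fun n :=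
  (kerKohn lam).starProjection

/-- The phase `φ_-(x, y)` for `x = (z, x_{2n+1})`, `y = (w, y_{2n+1})`. -/
def phaseMinus {n : ℕ} (lam : Fin n → ℝ) (x y : Heis n) : ℂ :=
  -(x.2 : ℂ) + y.2 + Complex.I * ∑ j, ((|lam j| * ‖x.1 j - y.1 j‖ ^ 2 : ℝ) : ℂ)
    + Complex.I * ∑ j, (lam j : ℂ) * (conj (x.1 j) * y.1 j - x.1 j * conj (y.1 j))

/-- `∫ (-i(φ(x,y) + iε))^{-(n+1)} u(y) dμ(y)`. -/
def regularizedIntegral {n : ℕ} (φ : Heis n → Heis n → ℂ) (ε : ℝ) (u : Heis n → ℂ)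
    (x : Heis n) : ℂ :=
  ∫ y, 1 / (-Complex.I * (φ x y + Complex.I * ε)) ^ (n + 1) * u y ∂(heisVol n)

/-- `I` is the bounded extension to `L²(H_{n+1})` of the operator `I_φ^{(0)}` on `C_c^∞(H_{n+1})`,
`(I_φ^{(0)} u)(x) = lim_{ε → 0+} ∫ (-i(φ(x,y) + iε))^{-(n+1)} u(y) dμ(y)`; the limit is required to
exist at every point `x`. -/
def IsL2Extension {n : ℕ} (φ : Heis n → Heis n → ℂ) (I : L2Fun n →L[ℂ] L2Fun n) : Prop :=
  ∀ (u : Heis n → ℂ) (hu : IsTest u), ∃ g : Heis n → ℂ,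
    (∀ x, Tendsto (fun ε : ℝ => regularizedIntegral φ ε u x) (𝓝[>] 0) (𝓝 (g x))) ∧
      I (hu.memLp.toLp u) =ᵐ[heisVol n] g

end Heisenberg

end

noncomputable section

namespace Heisenberg

variable {n : ℕ}

/-! For positive `λ` the function `-iφ_-(x, y)` is `polar lam x y`, which equals `gauge lam`
evaluated at `y⁻¹x` in the Heisenberg group, has nonnegative real part, and is annihilated by every
`Z̄_j` in `x`. So for `ε > 0` the kernel `S_ε(x, y) = (polar x y + ε)^{-(n+1)}` is CR in `x`, and it
lies in `L²`. Let `Π` be the Szegő projection. The regularized integral of a test function `φ` at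
`y` is the inner product of `φ` with the element `S_ε(·, y)` of the range of `Π`, so `φ` may be
replaced by `Πφ` (`integral_szegoKernel_eq`).

Against a CR function in `L²`, `S_ε` may in turn be exchanged for an approximate identity. By
`sum_Zbar_primitiveKernel` it differs from the kernel `poissonKernel` by a divergence `∑ Z̄_j(⋯)`,
which such a function annihilates (`IsWeakDbar.integral_mul_Zbar`,
`IsWeakDbar.integral_mul_szegoKernel`). `S_ε` has only the critical decay of order `-(2n+2)`;
`poissonKernel` decays faster, is integrable, is the normalized parabolic dilate of its value at `ε
= 1`, and has total mass `M = 2π^{n+1}/(n! ∏ λ_j)` (`integral_poissonKernel`). Hence the regularized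
integrals tend to `M Πφ` weakly (`tendsto_integral_poissonKernel`). No singular integral estimate is
needed: boundedness on `L²` is inherited from `Π`.

For the limit at every point, `n + 2` integrations by parts in `t` turn `a^{-(n+1)}` into a multiple
of `a log a - a`, which is continuous on the closed right half-plane. The regularized integrals thus
extend continuously to `ε = 0` (`exists_continuous_extension`). The pointwise and the weak limit
agree almost everywhere, so `M Π` is an extension of the operator; density of test functions makes
it the only one, and the constant of the theorem is `1/M`. -/

instance instIsAddHaarMeasureVolumePi : (volume : Measure (Fin n → ℂ)).IsAddHaarMeasure :=
  Measure.pi.isAddHaarMeasure _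

instance instIsAddHaarMeasureVolumeHeis : (volume : Measure (Heis n)).IsAddHaarMeasure :=
  inferInstanceAs (((volume : Measure (Fin n → ℂ)).prod (volume : Measure ℝ)).IsAddHaarMeasure)

/-! ### The Heisenberg group structure -/

/-- The Heisenberg group law. -/
def mul (lam : Fin n → ℝ) (y v : Heis n) : Heis n :=
  (y.1 + v.1, y.2 + v.2 + 2 * ∑ j, lam j * (v.1 j * conj (y.1 j)).im)

/-- The parabolic dilations of the Heisenberg group. -/
def dil (r : ℝ) (v : Heis n) : Heis n := (r • v.1, r ^ 2 * v.2)

/-- The complex gauge `∑ λ_j |v_j|² + i t`. -/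
def gauge (lam : Fin n → ℝ) (v : Heis n) : ℂ :=
  ((∑ j, lam j * ‖v.1 j‖ ^ 2 : ℝ) : ℂ) + Complex.I * v.2

/-- The function `-i φ_-(x, y)` for positive `λ`, as a polynomial that is CR in `x`. -/
def polar (lam : Fin n → ℝ) (x y : Heis n) : ℂ :=
  ∑ j, (lam j : ℂ) * (x.1 j * conj (x.1 j) + y.1 j * conj (y.1 j) - 2 * (x.1 j * conj (y.1 j)))
    + Complex.I * ((x.2 : ℂ) - y.2)

theorem continuous_mul (lam : Fin n → ℝ) : Continuous fun p : Heis n × Heis n => mul lam p.1 p.2 := by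
  unfold mul
  fun_prop

theorem continuous_dil : Continuous fun p : ℝ × Heis n => dil p.1 p.2 := by
  unfold dil
  fun_prop

theorem continuous_gauge (lam : Fin n → ℝ) : Continuous (gauge lam) := by
  unfold gauge
  fun_prop

theorem continuous_polar (lam : Fin n → ℝ) :
    Continuous fun p : Heis n × Heis n => polar lam p.1 p.2 := by
  unfold polar
  fun_prop

/-- Termwise `|a|² + |b|² - 2ab̄ = |a - b|² - 2i Im(ab̄)`, and the imaginary part is the twist in
the group law. The kernel is therefore a convolution kernel on the group. -/
theorem polar_eq_gauge (lam : Fin n → ℝ) (x y : Heis n) :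
    polar lam x y = gauge lam (mul lam (-y) x) := by
  have key : ∀ a b : ℂ, a * conj a + b * conj b - 2 * (a * conj b) =
      ((‖a - b‖ ^ 2 : ℝ) : ℂ) - 2 * Complex.I * ((a * conj b).im : ℂ) := by
    intro a b
    rw [← Complex.normSq_eq_norm_sq]
    apply Complex.ext <;> simp [Complex.normSq_apply] <;> ring
  simp only [polar, key, gauge, mul, Prod.fst_neg, Prod.snd_neg, Pi.sub_apply, Pi.neg_apply,
    neg_add_eq_sub, map_neg, mul_neg, Complex.neg_im, Finset.sum_neg_distrib, mul_sub,
    Finset.sum_sub_distrib]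
  push_cast
  have h : ∑ j, (lam j : ℂ) * (2 * Complex.I * ((x.1 j * conj (y.1 j)).im : ℂ)) =
      2 * Complex.I * ∑ j, (lam j : ℂ) * ((x.1 j * conj (y.1 j)).im : ℂ) := by
    rw [Finset.mul_sum]
    exact Finset.sum_congr rfl fun j _ => by ring
  rw [h]
  ring

theorem mul_neg_mul (lam : Fin n → ℝ) (y v : Heis n) : mul lam (-y) (mul lam y v) = v := by
  refine Prod.ext ?_ ?_
  · ext j
    simp [mul]
  · simp only [mul, Prod.fst_neg, Prod.snd_neg, Pi.add_apply, Pi.neg_apply, map_neg, mul_neg,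
      Complex.neg_im, Finset.sum_neg_distrib]
    have : ∀ j, ((y.1 j + v.1 j) * conj (y.1 j)).im = (v.1 j * conj (y.1 j)).im := by
      intro j; simp; ring
    simp only [this]
    ring

theorem mul_mul_neg (lam : Fin n → ℝ) (y v : Heis n) : mul lam (mul lam y v) (-v) = y := by
  refine Prod.ext ?_ ?_
  · ext j
    simp [mul]
  · simp only [mul, Prod.fst_neg, Prod.snd_neg, Pi.add_apply, Pi.neg_apply, mul_neg,
      Complex.neg_im, Finset.sum_neg_distrib, neg_mul]
    have : ∀ j, (v.1 j * conj (y.1 j + v.1 j)).im = (v.1 j * conj (y.1 j)).im := by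
      intro j; simp; ring
    simp only [this]
    ring

theorem polar_mul_left (lam : Fin n → ℝ) (y v : Heis n) :
    polar lam (mul lam y v) y = gauge lam v := by
  rw [polar_eq_gauge, mul_neg_mul]

theorem conj_polar (lam : Fin n → ℝ) (x y : Heis n) : conj (polar lam x y) = polar lam y x := by
  simp only [polar, map_add, map_sum, map_mul, map_sub, Complex.conj_ofReal, Complex.conj_I,
    Complex.conj_conj, map_ofNat]
  congr 1
  · exact Finset.sum_congr rfl fun j _ => by ring
  · ring

theorem gauge_re (lam : Fin n → ℝ) (v : Heis n) :
    (gauge lam v).re = ∑ j, lam j * ‖v.1 j‖ ^ 2 := by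
  rw [gauge, Complex.add_re, Complex.ofReal_re]
  simp

theorem gauge_im (lam : Fin n → ℝ) (v : Heis n) : (gauge lam v).im = v.2 := by
  rw [gauge, Complex.add_im, Complex.ofReal_im]
  simp

theorem gauge_re_nonneg {lam : Fin n → ℝ} (hlam : ∀ j, 0 < lam j) (v : Heis n) :
    0 ≤ (gauge lam v).re := by
  rw [gauge_re]
  exact Finset.sum_nonneg fun j _ => mul_nonneg (hlam j).le (sq_nonneg _)

theorem gauge_dil (lam : Fin n → ℝ) (r : ℝ) (v : Heis n) :
    gauge lam (dil r v) = r ^ 2 * gauge lam v := by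
  simp only [gauge, dil, Pi.smul_apply, norm_smul, mul_pow, Real.norm_eq_abs, sq_abs]
  push_cast
  rw [mul_add, Finset.mul_sum]
  congr 1
  · exact Finset.sum_congr rfl fun j _ => by ring
  · ring

theorem polar_re_nonneg {lam : Fin n → ℝ} (hlam : ∀ j, 0 < lam j) (x y : Heis n) :
    0 ≤ (polar lam x y).re := by
  rw [polar_eq_gauge]
  exact gauge_re_nonneg hlam _

theorem add_pos_ne_zero {a : ℂ} (ha : 0 ≤ a.re) {ε : ℝ} (hε : 0 < ε) : a + ε ≠ 0 := by
  intro h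
  have := congrArg Complex.re h
  simp at this
  linarith

/-- With `|λ_j| = λ_j`, one has `|z - w|² + z̄w - zw̄ = |z|² + |w|² - 2zw̄`: the terms in `z̄w`
cancel. -/
theorem phaseMinus_eq_polar {lam : Fin n → ℝ} (hlam : ∀ j, 0 < lam j) (x y : Heis n) (ε : ℝ) :
    -Complex.I * (phaseMinus lam x y + Complex.I * ε) = polar lam x y + ε := by
  have key : ∀ a b : ℂ, ((‖a - b‖ ^ 2 : ℝ) : ℂ) = (a - b) * conj (a - b) := by
    intro a b
    rw [Complex.mul_conj, Complex.normSq_eq_norm_sq]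
  have h1 : ∀ j, (((|lam j| * ‖x.1 j - y.1 j‖ ^ 2 : ℝ)) : ℂ) =
      lam j * ((x.1 j - y.1 j) * (conj (x.1 j) - conj (y.1 j))) := by
    intro j
    rw [abs_of_pos (hlam j), Complex.ofReal_mul, key, map_sub]
  simp only [phaseMinus, polar, h1]
  have h2 : ∀ j, (lam j : ℂ) *
        (x.1 j * conj (x.1 j) + y.1 j * conj (y.1 j) - 2 * (x.1 j * conj (y.1 j))) =
      lam j * ((x.1 j - y.1 j) * (conj (x.1 j) - conj (y.1 j))) +
        (lam j : ℂ) * (conj (x.1 j) * y.1 j - x.1 j * conj (y.1 j)) := fun j => by ring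
  simp only [h2, Finset.sum_add_distrib]
  linear_combination (-∑ j, (lam j : ℂ) * ((x.1 j - y.1 j) * (conj (x.1 j) - conj (y.1 j)))
    - ∑ j, (lam j : ℂ) * (conj (x.1 j) * y.1 j - x.1 j * conj (y.1 j)) - ε) * Complex.I_sq

/-! ### Invariance of the volume under translations, and its scaling under dilations. -/

theorem heis_volume_eq : (volume : Measure (Heis n)) = (volume : Measure (Fin n → ℂ)).prod volume :=
  rfl

/-- Left and right translations both shift `z` by a constant and `t` by an amount depending only on
`z`, so this one map covers both. -/
theorem measurePreserving_shear (w : Fin n → ℂ) (s : ℝ) {h : (Fin n → ℂ) → ℝ} (hh : Continuous h) :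
    MeasurePreserving (fun v : Heis n => ((v.1 + w, v.2 + s + h v.1) : Heis n))
      (heisVol n) (heisVol n) := by
  have : MeasurePreserving (fun v : Heis n => ((v.1 + w, v.2 + s + h v.1) : Heis n))
      volume volume := by
    refine MeasurePreserving.skew_product (g := fun a b => b + s + h a)
      (measurePreserving_add_right volume w) (by fun_prop) (ae_of_all _ fun a => ?_)
    simp only [add_assoc]
    exact (measurePreserving_add_right volume (s + h a)).map_eq
  exact this.smul_measure _

theorem measurePreserving_mul_left (lam : Fin n → ℝ) (y : Heis n) :
    MeasurePreserving (mul lam y) (heisVol n) (heisVol n) := by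
  have := measurePreserving_shear y.1 y.2
    (h := fun v => 2 * ∑ j, lam j * (v j * conj (y.1 j)).im) (by fun_prop)
  convert! this using 2 with v
  simp [mul, add_comm]

theorem measurePreserving_mul_right (lam : Fin n → ℝ) (v : Heis n) :
    MeasurePreserving (fun y => mul lam y v) (heisVol n) (heisVol n) :=
  measurePreserving_shear v.1 v.2
    (h := fun y => 2 * ∑ j, lam j * (v.1 j * conj (y j)).im) (by fun_prop)

/-- Left translation as a homeomorphism. -/
def mulLeftHomeo (lam : Fin n → ℝ) (y : Heis n) : Heis n ≃ₜ Heis n where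
  toFun := mul lam y
  invFun := mul lam (-y)
  left_inv v := mul_neg_mul lam y v
  right_inv v := by simpa using mul_neg_mul lam (-y) v
  continuous_toFun := (continuous_mul lam).comp (Continuous.prodMk_right y)
  continuous_invFun := (continuous_mul lam).comp (Continuous.prodMk_right (-y))

/-- Right translation as a homeomorphism. -/
def mulRightHomeo (lam : Fin n → ℝ) (v : Heis n) : Heis n ≃ₜ Heis n where
  toFun y := mul lam y v
  invFun y := mul lam y (-v)
  left_inv y := mul_mul_neg lam y v
  right_inv y := by simpa using mul_mul_neg lam y (-v)
  continuous_toFun := (continuous_mul lam).comp (Continuous.prodMk_left v)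
  continuous_invFun := (continuous_mul lam).comp (Continuous.prodMk_left (-v))

theorem integral_mul_left (lam : Fin n → ℝ) (y : Heis n) (F : Heis n → ℂ) :
    ∫ v, F (mul lam y v) ∂heisVol n = ∫ x, F x ∂heisVol n :=
  (measurePreserving_mul_left lam y).integral_comp
    (mulLeftHomeo lam y).measurableEmbedding F

theorem integral_mul_right (lam : Fin n → ℝ) (v : Heis n) (F : Heis n → ℂ) :
    ∫ y, F (mul lam y v) ∂heisVol n = ∫ x, F x ∂heisVol n :=
  (measurePreserving_mul_right lam v).integral_comp
    (mulRightHomeo lam v).measurableEmbedding F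

/-- `z` contributes `2n` real dimensions and `t`, scaled by `r²`, counts twice: the homogeneous
dimension is `2n + 2`. -/
theorem integral_dil {r : ℝ} (hr : 0 < r) (F : Heis n → ℂ) :
    ∫ v, F (dil r v) ∂heisVol n = ((r ^ (2 * n + 2))⁻¹ : ℝ) • ∫ x, F x ∂heisVol n := by
  have hm : Measure.map (dil r) (volume : Measure (Heis n)) =
      ENNReal.ofReal ((r ^ (2 * n + 2))⁻¹) • volume := by
    have h1 := Measure.map_addHaar_smul (volume : Measure (Fin n → ℂ)) hr.ne'
    have h2 := Measure.map_addHaar_smul (volume : Measure ℝ) (pow_pos hr 2).ne'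
    have h3 := Measure.map_prod_map (volume : Measure (Fin n → ℂ)) (volume : Measure ℝ)
      (measurable_const_smul r) (measurable_const_smul (r ^ 2))
    rw [h1, h2, Measure.prod_smul_left, Measure.prod_smul_right, smul_smul,
      ← ENNReal.ofReal_mul (abs_nonneg _)] at h3
    rw [heis_volume_eq]
    refine h3.symm.trans ?_
    congr 2
    rw [← abs_mul, abs_of_pos (by positivity)]
    simp only [Module.finrank_pi_fintype, Complex.finrank_real_complex, Finset.sum_const,
      Finset.card_univ, Fintype.card_fin, smul_eq_mul, Module.finrank_self, pow_one]
    rw [← mul_inv, ← pow_add, mul_comm n 2]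
  have hemb : MeasurableEmbedding (dil r : Heis n → Heis n) := by
    let e : Heis n ≃ₜ Heis n := (Homeomorph.smulOfNeZero r hr.ne').prodCongr
      (Homeomorph.smulOfNeZero (r ^ 2) (pow_pos hr 2).ne')
    exact e.measurableEmbedding
  rw [integral_smul_nnreal_measure, integral_smul_nnreal_measure, ← hemb.integral_map, hm,
    integral_smul_measure, ENNReal.toReal_ofReal (by positivity), smul_comm]

/-! ### The vector fields `Z̄_j` as derivations -/

/-- `Z̄_j` at `x` as a functional of the real derivative. -/
theorem Zbar_eq_of_hasFDerivAt (lam : Fin n → ℝ) (j : Fin n) {f : Heis n → ℂ} {x : Heis n}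
    {f' : Heis n →L[ℝ] ℂ} (h : HasFDerivAt f f' x) :
    Zbar lam j f x = (1 / 2) * (f' (Pi.single j 1, 0) + Complex.I * f' (Pi.single j Complex.I, 0))
      + Complex.I * lam j * x.1 j * f' (0, 1) := by
  simp only [Zbar, dzbar, dt, h.fderiv]

theorem Zbar_add (lam : Fin n → ℝ) (j : Fin n) {f g : Heis n → ℂ} {x : Heis n}
    (hf : DifferentiableAt ℝ f x) (hg : DifferentiableAt ℝ g x) :
    Zbar lam j (fun y => f y + g y) x = Zbar lam j f x + Zbar lam j g x := by
  rw [Zbar_eq_of_hasFDerivAt lam j (hf.hasFDerivAt.fun_add hg.hasFDerivAt),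
    Zbar_eq_of_hasFDerivAt lam j hf.hasFDerivAt, Zbar_eq_of_hasFDerivAt lam j hg.hasFDerivAt]
  simp only [add_apply]
  ring

theorem Zbar_sum (lam : Fin n → ℝ) (j : Fin n) {f : Fin n → Heis n → ℂ} {x : Heis n}
    (hf : ∀ k, DifferentiableAt ℝ (f k) x) :
    Zbar lam j (fun y => ∑ k, f k y) x = ∑ k, Zbar lam j (f k) x := by
  rw [Zbar_eq_of_hasFDerivAt lam j (HasFDerivAt.fun_sum fun k _ => (hf k).hasFDerivAt)]
  simp only [Zbar, dzbar, dt, FunLike.coe_sum, Finset.sum_apply,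
    Finset.sum_add_distrib, Finset.mul_sum, mul_add]

theorem Zbar_mul (lam : Fin n → ℝ) (j : Fin n) {f g : Heis n → ℂ} {x : Heis n}
    (hf : DifferentiableAt ℝ f x) (hg : DifferentiableAt ℝ g x) :
    Zbar lam j (fun y => f y * g y) x = f x * Zbar lam j g x + Zbar lam j f x * g x := by
  rw [Zbar_eq_of_hasFDerivAt lam j (hf.hasFDerivAt.fun_mul hg.hasFDerivAt),
    Zbar_eq_of_hasFDerivAt lam j hf.hasFDerivAt, Zbar_eq_of_hasFDerivAt lam j hg.hasFDerivAt]
  simp only [add_apply, smul_apply, smul_eq_mul]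
  ring

theorem Zbar_comp (lam : Fin n → ℝ) (j : Fin n) {f : Heis n → ℂ} {x : Heis n} {F : ℂ → ℂ} {F' : ℂ}
    (hF : HasDerivAt F F' (f x)) (hf : DifferentiableAt ℝ f x) :
    Zbar lam j (fun y => F (f y)) x = F' * Zbar lam j f x := by
  have h := HasFDerivAt.comp x (hF.hasFDerivAt.restrictScalars ℝ) hf.hasFDerivAt
  have h2 : HasFDerivAt (fun y => F (f y)) _ x := h
  rw [Zbar_eq_of_hasFDerivAt lam j h2, Zbar_eq_of_hasFDerivAt lam j hf.hasFDerivAt]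
  simp
  ring

theorem Zbar_const (lam : Fin n → ℝ) (j : Fin n) (c : ℂ) (x : Heis n) :
    Zbar lam j (fun _ => c) x = 0 := by
  rw [Zbar_eq_of_hasFDerivAt lam j (hasFDerivAt_const c x)]
  simp

theorem Zbar_clm (lam : Fin n → ℝ) (j : Fin n) (L : Heis n →L[ℝ] ℂ) (x : Heis n) :
    Zbar lam j (fun y => L y) x =
      (1 / 2) * (L (Pi.single j 1, 0) + Complex.I * L (Pi.single j Complex.I, 0))
      + Complex.I * lam j * x.1 j * L (0, 1) :=
  Zbar_eq_of_hasFDerivAt lam j L.hasFDerivAt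

/-- The coordinate `z_k` as a real-linear functional. -/
def coordCLM (k : Fin n) : Heis n →L[ℝ] ℂ :=
  (ContinuousLinearMap.proj (R := ℝ) (φ := fun _ : Fin n => ℂ) k).comp
    (ContinuousLinearMap.fst ℝ (Fin n → ℂ) ℝ)

theorem Zbar_coord (lam : Fin n → ℝ) (j k : Fin n) (x : Heis n) :
    Zbar lam j (fun y => y.1 k) x = 0 := by
  have := Zbar_clm lam j (coordCLM k) x
  refine this.trans ?_
  rcases eq_or_ne k j with rfl | h
  · simp [coordCLM]
  · simp [coordCLM, h]

theorem Zbar_conj_coord (lam : Fin n → ℝ) (j k : Fin n) (x : Heis n) :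
    Zbar lam j (fun y => conj (y.1 k)) x = if k = j then 1 else 0 := by
  have := Zbar_clm lam j ((Complex.conjCLE : ℂ →L[ℝ] ℂ).comp (coordCLM k)) x
  refine this.trans ?_
  rcases eq_or_ne k j with rfl | h
  · simp [coordCLM]
    norm_num
  · simp [coordCLM, h]

theorem Zbar_time (lam : Fin n → ℝ) (j : Fin n) (x : Heis n) :
    Zbar lam j (fun y => (y.2 : ℂ)) x = Complex.I * lam j * x.1 j := by
  have := Zbar_clm lam j (Complex.ofRealCLM.comp (ContinuousLinearMap.snd ℝ (Fin n → ℂ) ℝ)) x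
  refine this.trans ?_
  simp

theorem contDiff_conj_coord (j : Fin n) : ContDiff ℝ ∞ (fun x : Heis n => conj (x.1 j)) :=
  Complex.conjCLE.contDiff.comp (contDiff_coord j)

theorem contDiff_time : ContDiff ℝ ∞ (fun x : Heis n => (x.2 : ℂ)) :=
  Complex.ofRealCLM.contDiff.comp contDiff_snd

theorem contDiff_polar_left (lam : Fin n → ℝ) (y : Heis n) :
    ContDiff ℝ ∞ fun x => polar lam x y := by
  unfold polar
  refine ContDiff.add (ContDiff.sum fun j _ => contDiff_const.mul ?_)
    (contDiff_const.mul (contDiff_time.sub contDiff_const))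
  exact (((contDiff_coord j).mul (contDiff_conj_coord j)).add contDiff_const).sub
    (contDiff_const.mul ((contDiff_coord j).mul contDiff_const))

theorem contDiff_polar_right (lam : Fin n → ℝ) (y : Heis n) :
    ContDiff ℝ ∞ fun x => polar lam y x := by
  have := Complex.conjCLE.contDiff.comp (contDiff_polar_left lam y)
  convert! this using 2 with x
  simp [conj_polar]

theorem differentiableAt_of_contDiff {f : Heis n → ℂ} (hf : ContDiff ℝ ∞ f) (x : Heis n) :
    DifferentiableAt ℝ f x :=
  (hf.differentiable (by simp)).differentiableAt

theorem Zbar_const_mul (lam : Fin n → ℝ) (j : Fin n) {f : Heis n → ℂ} {x : Heis n} (c : ℂ)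
    (hf : DifferentiableAt ℝ f x) : Zbar lam j (fun y => c * f y) x = c * Zbar lam j f x := by
  rw [Zbar_mul lam j (differentiableAt_const c) hf, Zbar_const]
  ring

/-- `Z̄_j` sends `λ_j z_j z̄_j` to `λ_j z_j` and `it` to `i · iλ_j z_j`; the two cancel. -/
theorem Zbar_polar_left (lam : Fin n → ℝ) (j : Fin n) (x y : Heis n) :
    Zbar lam j (fun x => polar lam x y) x = 0 := by
  have hz : ∀ k, DifferentiableAt ℝ (fun x : Heis n => x.1 k) x := fun k =>
    differentiableAt_of_contDiff (contDiff_coord k) x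
  have hc : ∀ k, DifferentiableAt ℝ (fun x : Heis n => conj (x.1 k)) x := fun k =>
    differentiableAt_of_contDiff (contDiff_conj_coord k) x
  have ht : DifferentiableAt ℝ (fun x : Heis n => (x.2 : ℂ)) x :=
    differentiableAt_of_contDiff contDiff_time x
  have e : (fun x : Heis n => polar lam x y) = fun x =>
      ∑ k, ((lam k : ℂ) * (x.1 k * conj (x.1 k)) +
        (x.1 k * (-2 * (lam k : ℂ) * conj (y.1 k)) + lam k * (y.1 k * conj (y.1 k))))
      + (Complex.I * (x.2 : ℂ) + -(Complex.I * y.2)) := by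
    funext x
    rw [polar]
    congr 1
    · exact Finset.sum_congr rfl fun k _ => by ring
    · ring
  have hd1 : ∀ k, DifferentiableAt ℝ (fun x : Heis n => (lam k : ℂ) * (x.1 k * conj (x.1 k))) x :=
    fun k => ((hz k).fun_mul (hc k)).const_mul _
  have hd2 : ∀ k, DifferentiableAt ℝ (fun x : Heis n => x.1 k * (-2 * (lam k : ℂ) * conj (y.1 k))
      + lam k * (y.1 k * conj (y.1 k))) x := fun k => ((hz k).mul_const _).add_const _
  rw [e, Zbar_add lam j (DifferentiableAt.fun_sum fun k _ => (hd1 k).fun_add (hd2 k))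
    ((ht.const_mul _).add_const _), Zbar_sum lam j (fun k => (hd1 k).fun_add (hd2 k)),
    Zbar_add lam j (ht.const_mul _) (differentiableAt_const _), Zbar_const,
    Zbar_const_mul lam j _ ht, Zbar_time]
  have : ∀ k, Zbar lam j (fun x : Heis n => (lam k : ℂ) * (x.1 k * conj (x.1 k)) +
        (x.1 k * (-2 * (lam k : ℂ) * conj (y.1 k)) + lam k * (y.1 k * conj (y.1 k)))) x =
      if k = j then (lam k : ℂ) * x.1 k else 0 := by
    intro k
    rw [Zbar_add lam j (hd1 k) (hd2 k), Zbar_const_mul lam j _ ((hz k).fun_mul (hc k)),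
      Zbar_mul lam j (hz k) (hc k), Zbar_coord, Zbar_conj_coord,
      Zbar_add lam j ((hz k).mul_const _) (differentiableAt_const _), Zbar_const,
      Zbar_mul lam j (hz k) (differentiableAt_const _), Zbar_coord, Zbar_const]
    split_ifs <;> simp
  simp only [this, Finset.sum_ite_eq', Finset.mem_univ, if_true]
  linear_combination (lam j * x.1 j) * Complex.I_sq

theorem polar_add_polar (lam : Fin n → ℝ) (x y : Heis n) :
    polar lam y x + polar lam x y = 2 * ∑ j, (lam j : ℂ) *
      ((x.1 j - y.1 j) * conj (x.1 j - y.1 j)) := by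
  simp only [polar, Finset.mul_sum]
  have h : ∀ j, (2 : ℂ) * (lam j * ((x.1 j - y.1 j) * conj (x.1 j - y.1 j))) =
      (lam j : ℂ) * (y.1 j * conj (y.1 j) + x.1 j * conj (x.1 j) - 2 * (y.1 j * conj (x.1 j))) +
      (lam j : ℂ) * (x.1 j * conj (x.1 j) + y.1 j * conj (y.1 j) - 2 * (x.1 j * conj (y.1 j))) := by
    intro j
    rw [map_sub]
    ring
  simp only [h, Finset.sum_add_distrib]
  ring

/-- The two orders of `polar` add up to `2 ∑ λ_k |z_k - w_k|²` and one of them is CR, so only this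
quadratic contributes. -/
theorem Zbar_polar_right (lam : Fin n → ℝ) (j : Fin n) (x y : Heis n) :
    Zbar lam j (fun x => polar lam y x) x = 2 * lam j * (x.1 j - y.1 j) := by
  have e : (fun x : Heis n => polar lam y x) = fun x =>
      ∑ k, (2 * lam k : ℂ) * ((x.1 k + -y.1 k) * (conj (x.1 k) + -conj (y.1 k)))
        + (-1) * polar lam x y := by
    funext x
    have := polar_add_polar lam x y
    simp only [Finset.mul_sum, map_sub] at this
    rw [eq_sub_of_add_eq this, sub_eq_add_neg]
    congr 1
    · exact Finset.sum_congr rfl fun k _ => by ring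
    · ring
  have hz : ∀ k, DifferentiableAt ℝ (fun x : Heis n => x.1 k) x := fun k =>
    differentiableAt_of_contDiff (contDiff_coord k) x
  have hc : ∀ k, DifferentiableAt ℝ (fun x : Heis n => conj (x.1 k)) x := fun k =>
    differentiableAt_of_contDiff (contDiff_conj_coord k) x
  have hp := differentiableAt_of_contDiff (contDiff_polar_left lam y) x
  have hd : ∀ k, DifferentiableAt ℝ (fun x : Heis n =>
      (2 * lam k : ℂ) * ((x.1 k + -y.1 k) * (conj (x.1 k) + -conj (y.1 k)))) x := fun k =>
    (((hz k).add_const _).fun_mul ((hc k).add_const _)).const_mul _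
  rw [e, Zbar_add lam j (DifferentiableAt.fun_sum fun k _ => hd k) (hp.const_mul _),
    Zbar_sum lam j hd, Zbar_const_mul lam j _ hp, Zbar_polar_left]
  have : ∀ k, Zbar lam j (fun x : Heis n =>
      (2 * lam k : ℂ) * ((x.1 k + -y.1 k) * (conj (x.1 k) + -conj (y.1 k)))) x =
      if k = j then 2 * (lam k : ℂ) * (x.1 k - y.1 k) else 0 := by
    intro k
    rw [Zbar_const_mul lam j _ (((hz k).add_const _).fun_mul ((hc k).add_const _)),
      Zbar_mul lam j ((hz k).add_const _) ((hc k).add_const _),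
      Zbar_add lam j (hz k) (differentiableAt_const _),
      Zbar_add lam j (hc k) (differentiableAt_const _), Zbar_const, Zbar_const, Zbar_coord,
      Zbar_conj_coord]
    split_ifs <;> simp [sub_eq_add_neg]
  simp only [this, Finset.sum_ite_eq', Finset.mem_univ, if_true]
  ring

/-! ### The kernel and its primitive -/

/-- The regularized Szegő kernel `(-i(φ_-(x, y) + iε))^{-(n+1)}`. -/
def szegoKernel (lam : Fin n → ℝ) (ε : ℝ) (x y : Heis n) : ℂ := ((polar lam x y + ε) ^ (n + 1))⁻¹

/-- The `j`-th coefficient of the form whose divergence compares the Szegő kernel with an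
approximate identity. -/
def primitiveKernel (lam : Fin n → ℝ) (ε : ℝ) (j : Fin n) (y x : Heis n) : ℂ :=
  (conj (x.1 j) + -conj (y.1 j)) * (((polar lam y x + ε) ^ n)⁻¹ * (polar lam x y + ε)⁻¹)

variable {lam : Fin n → ℝ}

theorem polar_add_ne_zero (hlam : ∀ j, 0 < lam j) {ε : ℝ} (hε : 0 < ε) (x y : Heis n) :
    polar lam x y + ε ≠ 0 :=
  add_pos_ne_zero (polar_re_nonneg hlam x y) hε

theorem contDiff_szegoKernel (hlam : ∀ j, 0 < lam j) {ε : ℝ} (hε : 0 < ε) (y : Heis n) :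
    ContDiff ℝ ∞ fun x => szegoKernel lam ε x y :=
  (((contDiff_polar_left lam y).add contDiff_const).pow _).inv
    fun x => pow_ne_zero _ (polar_add_ne_zero hlam hε x y)

theorem contDiff_primitiveKernel (hlam : ∀ j, 0 < lam j) {ε : ℝ} (hε : 0 < ε) (j : Fin n)
    (y : Heis n) : ContDiff ℝ ∞ (primitiveKernel lam ε j y) :=
  ((contDiff_conj_coord j).add contDiff_const).mul
    (((((contDiff_polar_right lam y).add contDiff_const).pow _).inv
      fun x => pow_ne_zero _ (polar_add_ne_zero hlam hε y x)).mul
    (((contDiff_polar_left lam y).add contDiff_const).inv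
      fun x => polar_add_ne_zero hlam hε x y))

theorem Zbar_szegoKernel (hlam : ∀ j, 0 < lam j) {ε : ℝ} (hε : 0 < ε) (j : Fin n) (x y : Heis n) :
    Zbar lam j (fun x => szegoKernel lam ε x y) x = 0 := by
  have hp := differentiableAt_of_contDiff (contDiff_polar_left lam y) x
  have hne := polar_add_ne_zero hlam hε x y
  have h := Zbar_comp lam j (F := fun a => ((a + ε) ^ (n + 1))⁻¹) (f := fun x => polar lam x y)
    (x := x) (((hasDerivAt_id' _).add_const (ε : ℂ)).fun_pow (n + 1) |>.inv (pow_ne_zero _ hne)) hp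
  refine h.trans ?_
  rw [Zbar_polar_left, mul_zero]

theorem Zbar_primitiveKernel (hlam : ∀ j, 0 < lam j) {ε : ℝ} (hε : 0 < ε) (j : Fin n)
    (x y : Heis n) :
    Zbar lam j (primitiveKernel lam ε j y) x =
      ((polar lam y x + ε) ^ (n + 1))⁻¹ * (polar lam x y + ε)⁻¹ *
        (polar lam y x + ε - 2 * n * (lam j * ((x.1 j - y.1 j) * conj (x.1 j - y.1 j)))) := by
  have hne := polar_add_ne_zero hlam hε x y
  have hne' := polar_add_ne_zero hlam hε y x
  have hp := differentiableAt_of_contDiff (contDiff_polar_left lam y) x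
  have hp' := differentiableAt_of_contDiff (contDiff_polar_right lam y) x
  have hc := differentiableAt_of_contDiff (contDiff_conj_coord j) x
  have hd : HasDerivAt (fun a : ℂ => ((a + ε) ^ n)⁻¹)
      (-n * ((polar lam y x + ε) ^ (n + 1))⁻¹) (polar lam y x) := by
    convert! ((hasDerivAt_id' _).add_const (ε : ℂ)).fun_pow n |>.inv (pow_ne_zero _ hne') using 1
    -- The power rule produces the exponent `n - 1`, which truncates at `n = 0`.
    rcases n with _ | m
    · simp
    · simp only [Nat.add_sub_cancel]
      field_simp
      ring
  have hd2 : HasDerivAt (fun a : ℂ => (a + ε)⁻¹) _ (polar lam x y) :=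
    ((hasDerivAt_id' _).add_const (ε : ℂ)).inv hne
  have h1 := Zbar_comp lam j (f := fun x => polar lam y x) (x := x) hd hp'
  have h2 := Zbar_comp lam j (f := fun x => polar lam x y) (x := x) hd2 hp
  have d1 : DifferentiableAt ℝ (fun x => ((polar lam y x + ε) ^ n)⁻¹) x :=
    ((hp'.add_const _).pow n).inv (pow_ne_zero _ hne')
  have d2 : DifferentiableAt ℝ (fun x => (polar lam x y + (ε : ℂ))⁻¹) x :=
    (hp.add_const _).inv hne
  unfold primitiveKernel
  rw [Zbar_mul lam j (hc.add_const _) (d1.fun_mul d2), Zbar_mul lam j d1 d2, h1, h2,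
    Zbar_polar_left, Zbar_polar_right, Zbar_add lam j hc (differentiableAt_const _), Zbar_const,
    Zbar_conj_coord, if_pos rfl, map_sub, pow_succ]
  field_simp
  ring

/-- Put `A = polar x y + ε` and `B = polar y x + ε`. The CR factor `A⁻¹` passes through `Z̄_j`, so
the sum is `n B^{-(n+1)} A⁻¹ (B - 2 ∑ λ_j |z_j - w_j|²)`. Since `A + B = 2 ∑ λ_j |z_j - w_j|² + 2ε`,
the bracket is `2ε - A`, and `A⁻¹` cancels against `A` to leave the Szegő kernel. -/
theorem sum_Zbar_primitiveKernel (hlam : ∀ j, 0 < lam j) {ε : ℝ} (hε : 0 < ε) (x y : Heis n) :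
    ∑ j, Zbar lam j (primitiveKernel lam ε j y) x =
      n * (2 * ε * ((polar lam y x + ε) ^ (n + 1))⁻¹ * (polar lam x y + ε)⁻¹
        - szegoKernel lam ε y x) := by
  have hne := polar_add_ne_zero hlam hε x y
  simp only [Zbar_primitiveKernel hlam hε, ← Finset.mul_sum, Finset.sum_sub_distrib,
    Finset.sum_const, Finset.card_univ, Fintype.card_fin, nsmul_eq_mul]
  have h := polar_add_polar lam x y
  have h' : (n : ℂ) * (polar lam y x + ε) - 2 * n * ∑ j, (lam j : ℂ) *
      ((x.1 j - y.1 j) * conj (x.1 j - y.1 j)) = n * (2 * ε - (polar lam x y + ε)) := by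
    linear_combination (n : ℂ) * h
  rw [h', szegoKernel]
  field_simp

/-! ### Integrability of the kernels -/

theorem exists_pos_forall_le (hlam : ∀ j, 0 < lam j) : ∃ c : ℝ, 0 < c ∧ ∀ j, c ≤ lam j := by
  rcases isEmpty_or_nonempty (Fin n) with h | h
  · exact ⟨1, one_pos, fun j => h.elim j⟩
  · obtain ⟨i, hi⟩ := Finite.exists_min lam
    exact ⟨lam i, hlam i, hi⟩

theorem le_norm_add {a : ℂ} (ha : 0 ≤ a.re) (ε : ℝ) : ε ≤ ‖a + ε‖ := by
  have := Complex.re_le_norm (a + ε)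
  simp at this
  linarith

theorem mul_norm_sq_le_gauge (hlam : ∀ j, 0 < lam j) {ε : ℝ} (hε : 0 ≤ ε) (v : Heis n) (j : Fin n) :
    lam j * ‖v.1 j‖ ^ 2 ≤ ‖gauge lam v + ε‖ := by
  have h1 := Complex.re_le_norm (gauge lam v + ε)
  have h2 : lam j * ‖v.1 j‖ ^ 2 ≤ ∑ k, lam k * ‖v.1 k‖ ^ 2 :=
    Finset.single_le_sum (f := fun k => lam k * ‖v.1 k‖ ^ 2)
      (fun k _ => mul_nonneg (hlam k).le (sq_nonneg _)) (Finset.mem_univ j)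
  rw [Complex.add_re, gauge_re, Complex.ofReal_re] at h1
  linarith

/-- The real part controls `|z|²`, the imaginary part controls `|t|`, and `ε` controls the constant
`1`. -/
theorem exists_gauge_lower_bound (hlam : ∀ j, 0 < lam j) {ε : ℝ} (hε : 0 < ε) :
    ∃ c : ℝ, 0 < c ∧ ∀ v : Heis n, c * (1 + ‖v.1‖) ^ 2 ≤ ‖gauge lam v + ε‖ ∧
      c * (1 + ‖v.2‖) ≤ ‖gauge lam v + ε‖ := by
  obtain ⟨b, hb, hbl⟩ := exists_pos_forall_le hlam
  refine ⟨(2 / ε + 2 / b + 1)⁻¹, by positivity, fun v => ?_⟩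
  set N := ‖gauge lam v + ε‖
  have hN : ε ≤ N := le_norm_add (gauge_re_nonneg hlam v) ε
  have hN0 : 0 < N := hε.trans_le hN
  have h1 : ‖v.1‖ ^ 2 ≤ N / b := by
    have : ‖v.1‖ ≤ √(N / b) := by
      refine (pi_norm_le_iff_of_nonneg (Real.sqrt_nonneg _)).2 fun j => ?_
      refine Real.le_sqrt_of_sq_le ?_
      rw [le_div_iff₀ hb]
      calc ‖v.1 j‖ ^ 2 * b ≤ lam j * ‖v.1 j‖ ^ 2 := by
            rw [mul_comm]
            exact mul_le_mul_of_nonneg_right (hbl j) (sq_nonneg _)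
        _ ≤ N := mul_norm_sq_le_gauge hlam hε.le v j
    calc ‖v.1‖ ^ 2 ≤ √(N / b) ^ 2 := by gcongr
      _ = N / b := Real.sq_sqrt (by positivity)
  have h2 : ‖v.2‖ ≤ N := by
    have := Complex.abs_im_le_norm (gauge lam v + ε)
    rw [Complex.add_im, gauge_im, Complex.ofReal_im, add_zero] at this
    exact this
  have h3 : 1 ≤ N / ε := (one_le_div hε).2 hN
  have h4 : 0 < N / b := by positivity
  have e : (2 / ε + 2 / b + 1) * N = 2 * (N / ε) + 2 * (N / b) + N := by ring
  constructor
  · rw [inv_mul_le_iff₀ (by positivity), e]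
    nlinarith [sq_nonneg (1 - ‖v.1‖)]
  · rw [inv_mul_le_iff₀ (by positivity), e]
    linarith

theorem integrable_gauge_critical (hlam : ∀ j, 0 < lam j) {ε : ℝ} (hε : 0 < ε) :
    Integrable (fun v => (‖gauge lam v + ε‖ ^ (n + 2))⁻¹) (heisVol n) := by
  obtain ⟨c, hc, hb⟩ := exists_gauge_lower_bound hlam hε
  -- The power `n + 2` is split as `(n + 1/2) + 3/2`. The two lower bounds, quadratic in `1 + |z|`
  -- and linear in `1 + |t|`, then give decay of order `2n + 1` in `2n` real dimensions and `3/2` in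
  -- one dimension.
  have i1 : Integrable (fun w : Fin n → ℂ => (1 + ‖w‖) ^ (-(2 * n + 1 : ℝ))) := by
    refine integrable_one_add_norm ?_
    simp [Module.finrank_pi_fintype]
    linarith
  have i2 : Integrable (fun t : ℝ => (1 + ‖t‖) ^ (-(3 / 2 : ℝ))) := by
    refine integrable_one_add_norm ?_
    simp
    norm_num
  have i3 : Integrable (fun v : Heis n => (c ^ (-(n + 1 / 2 : ℝ)) * c ^ (-(3 / 2 : ℝ))) *
      ((1 + ‖v.1‖) ^ (-(2 * n + 1 : ℝ)) * (1 + ‖v.2‖) ^ (-(3 / 2 : ℝ)))) (heisVol n) :=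
    ((i1.mul_prod i2).const_mul _).smul_measure_nnreal
  refine i3.mono' ?_ (ae_of_all _ fun v => ?_)
  · have hcont : Continuous fun v => (‖gauge lam v + ε‖ ^ (n + 2))⁻¹ :=
      ((((continuous_gauge lam).add continuous_const).norm).pow _).inv₀ fun v =>
        pow_ne_zero _ (norm_ne_zero_iff.2 (add_pos_ne_zero (gauge_re_nonneg hlam v) hε))
    exact hcont.aestronglyMeasurable
  · obtain ⟨h1, h2⟩ := hb v
    have hN0 : 0 < ‖gauge lam v + ε‖ :=
      norm_pos_iff.2 (add_pos_ne_zero (gauge_re_nonneg hlam v) hε)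
    rw [Real.norm_of_nonneg (by positivity)]
    have e : (‖gauge lam v + ε‖ ^ (n + 2))⁻¹ =
        ‖gauge lam v + ε‖ ^ (-(n + 1 / 2 : ℝ)) * ‖gauge lam v + ε‖ ^ (-(3 / 2 : ℝ)) := by
      rw [← Real.rpow_add hN0, ← Real.rpow_natCast, ← Real.rpow_neg hN0.le]
      congr 1
      push_cast
      ring
    have p1 : 0 < 1 + ‖v.1‖ := by positivity
    have p2 : 0 < 1 + ‖v.2‖ := by positivity
    have b1 : ‖gauge lam v + ε‖ ^ (-(n + 1 / 2 : ℝ)) ≤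
        c ^ (-(n + 1 / 2 : ℝ)) * (1 + ‖v.1‖) ^ (-(2 * n + 1 : ℝ)) := by
      refine (Real.rpow_le_rpow_of_nonpos (by positivity) h1
        (by have : (0 : ℝ) ≤ n := n.cast_nonneg
            linarith)).trans_eq ?_
      rw [Real.mul_rpow hc.le (by positivity), ← Real.rpow_natCast, ← Real.rpow_mul p1.le]
      congr 2
      push_cast
      ring
    have b2 : ‖gauge lam v + ε‖ ^ (-(3 / 2 : ℝ)) ≤
        c ^ (-(3 / 2 : ℝ)) * (1 + ‖v.2‖) ^ (-(3 / 2 : ℝ)) := by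
      refine (Real.rpow_le_rpow_of_nonpos (by positivity) h2 (by norm_num)).trans_eq ?_
      rw [Real.mul_rpow hc.le (by positivity)]
    rw [e]
    calc _ ≤ (c ^ (-(n + 1 / 2 : ℝ)) * (1 + ‖v.1‖) ^ (-(2 * n + 1 : ℝ))) *
          (c ^ (-(3 / 2 : ℝ)) * (1 + ‖v.2‖) ^ (-(3 / 2 : ℝ))) := by gcongr
      _ = _ := by ring

theorem integrable_gauge (hlam : ∀ j, 0 < lam j) {ε : ℝ} (hε : 0 < ε) {m : ℕ} (hm : n + 2 ≤ m) :
    Integrable (fun v => (‖gauge lam v + ε‖ ^ m)⁻¹) (heisVol n) := by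
  obtain ⟨k, rfl⟩ := Nat.exists_eq_add_of_le hm
  refine ((integrable_gauge_critical hlam hε).const_mul (ε ^ k)⁻¹).mono' ?_
    (ae_of_all _ fun v => ?_)
  · have hcont : Continuous fun v => (‖gauge lam v + ε‖ ^ (n + 2 + k))⁻¹ :=
      ((((continuous_gauge lam).add continuous_const).norm).pow _).inv₀ fun v =>
        pow_ne_zero _ (norm_ne_zero_iff.2 (add_pos_ne_zero (gauge_re_nonneg hlam v) hε))
    exact hcont.aestronglyMeasurable
  · have hN : ε ≤ ‖gauge lam v + ε‖ := le_norm_add (gauge_re_nonneg hlam v) ε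
    have hN0 : 0 < ‖gauge lam v + ε‖ := hε.trans_le hN
    rw [Real.norm_of_nonneg (by positivity), pow_add, mul_inv, mul_comm]
    gcongr

theorem integrable_polar (hlam : ∀ j, 0 < lam j) {ε : ℝ} (hε : 0 < ε) (y : Heis n) {m : ℕ}
    (hm : n + 2 ≤ m) : Integrable (fun x => (‖polar lam x y + ε‖ ^ m)⁻¹) (heisVol n) := by
  simp only [polar_eq_gauge]
  exact (measurePreserving_mul_left lam (-y)).integrable_comp_of_integrable
    (integrable_gauge hlam hε hm)

theorem norm_polar_swap (lam : Fin n → ℝ) (x y : Heis n) (ε : ℝ) :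
    ‖polar lam y x + ε‖ = ‖polar lam x y + ε‖ := by
  rw [← conj_polar lam x y, ← RCLike.norm_conj (polar lam x y + ε), map_add, Complex.conj_ofReal]

theorem conj_szegoKernel (lam : Fin n → ℝ) (ε : ℝ) (x y : Heis n) :
    conj (szegoKernel lam ε x y) = szegoKernel lam ε y x := by
  simp [szegoKernel, conj_polar]

/-- The exponent `2n + 1` reaches the integrability threshold `n + 2` exactly when `n ≥ 1`. -/
theorem memLp_two_of_norm_le (hn : 1 ≤ n) (hlam : ∀ j, 0 < lam j) {ε : ℝ} (hε : 0 < ε)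
    {F : Heis n → ℂ} (hF : Continuous F) (y : Heis n) (C : ℝ)
    (h : ∀ x, ‖F x‖ ^ 2 ≤ C * (‖polar lam x y + ε‖ ^ (2 * n + 1))⁻¹) :
    MemLp F 2 (heisVol n) := by
  rw [memLp_two_iff_integrable_sq_norm hF.aestronglyMeasurable]
  refine ((integrable_polar hlam hε y (m := 2 * n + 1) (by omega)).const_mul C).mono'
    (hF.norm.pow 2).aestronglyMeasurable (ae_of_all _ fun x => ?_)
  rw [Real.norm_of_nonneg (by positivity)]
  exact h x

theorem inv_pow_le {ε : ℝ} (hε : 0 < ε) {N : ℝ} (hN : ε ≤ N) (m : ℕ) :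
    (N ^ (m + 1))⁻¹ ≤ ε⁻¹ * (N ^ m)⁻¹ := by
  have : 0 < N := hε.trans_le hN
  rw [pow_succ, mul_inv, mul_comm]
  gcongr

theorem memLp_szegoKernel (hn : 1 ≤ n) (hlam : ∀ j, 0 < lam j) {ε : ℝ} (hε : 0 < ε) (y : Heis n) :
    MemLp (fun x => szegoKernel lam ε x y) 2 (heisVol n) := by
  refine memLp_two_of_norm_le hn hlam hε (contDiff_szegoKernel hlam hε y).continuous y ε⁻¹
    fun x => ?_
  rw [szegoKernel, norm_inv, norm_pow, inv_pow, ← pow_mul,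
    show (n + 1) * 2 = 2 * n + 1 + 1 by ring]
  exact inv_pow_le hε (le_norm_add (polar_re_nonneg hlam x y) ε) (2 * n + 1)

theorem mul_norm_sq_le_polar (hlam : ∀ j, 0 < lam j) {ε : ℝ} (hε : 0 ≤ ε) (x y : Heis n)
    (j : Fin n) : lam j * ‖x.1 j - y.1 j‖ ^ 2 ≤ ‖polar lam x y + ε‖ := by
  have := mul_norm_sq_le_gauge hlam hε (mul lam (-y) x) j
  rw [← polar_eq_gauge] at this
  simpa [mul, neg_add_eq_sub] using this

/-- With `N` the norm of `polar x y + ε`, the numerator obeys `λ_j |z_j - w_j|² ≤ N`, which costs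
one power in `N^{-(2n+2)}`. -/
theorem memLp_primitiveKernel (hn : 1 ≤ n) (hlam : ∀ j, 0 < lam j) {ε : ℝ} (hε : 0 < ε)
    (j : Fin n) (y : Heis n) : MemLp (primitiveKernel lam ε j y) 2 (heisVol n) := by
  refine memLp_two_of_norm_le hn hlam hε (contDiff_primitiveKernel hlam hε j y).continuous y
    (lam j)⁻¹ fun x => ?_
  have h1 := mul_norm_sq_le_polar hlam hε.le x y j
  have hN0 : 0 < ‖polar lam x y + ε‖ := norm_pos_iff.2 (polar_add_ne_zero hlam hε x y)
  have h2 : ‖conj (x.1 j) + -conj (y.1 j)‖ = ‖x.1 j - y.1 j‖ := by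
    rw [← sub_eq_add_neg, ← map_sub, RCLike.norm_conj]
  rw [primitiveKernel, norm_mul, norm_mul, norm_inv, norm_inv, norm_pow, h2, norm_polar_swap]
  set N := ‖polar lam x y + ε‖
  have h3 : ‖x.1 j - y.1 j‖ ^ 2 ≤ (lam j)⁻¹ * N := by
    rw [← div_eq_inv_mul, le_div_iff₀ (hlam j), mul_comm]
    exact h1
  calc (‖x.1 j - y.1 j‖ * ((N ^ n)⁻¹ * N⁻¹)) ^ 2
      = ‖x.1 j - y.1 j‖ ^ 2 * (N ^ (2 * n + 2))⁻¹ := by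
        rw [← mul_inv, ← pow_succ, mul_pow, inv_pow, ← pow_mul]
        congr 3
        ring
    _ ≤ (lam j)⁻¹ * N * (N ^ (2 * n + 2))⁻¹ := by gcongr
    _ = (lam j)⁻¹ * (N ^ (2 * n + 1))⁻¹ := by
        field_simp
        ring

theorem contDiff_Zbar (lam : Fin n → ℝ) (j : Fin n) {f : Heis n → ℂ} (hf : ContDiff ℝ ∞ f) :
    ContDiff ℝ ∞ (Zbar lam j f) := by
  have h : ∀ e : Heis n, ContDiff ℝ ∞ fun x => fderiv ℝ f x e := fun e =>
    (hf.fderiv_right (by simp)).clm_apply contDiff_const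
  exact (contDiff_const.mul ((h _).add (contDiff_const.mul (h _)))).add
    (((contDiff_const.mul contDiff_const).mul (contDiff_coord j)).mul (h _))

theorem memLp_Zbar_primitiveKernel (hn : 1 ≤ n) (hlam : ∀ j, 0 < lam j) {ε : ℝ} (hε : 0 < ε)
    (j : Fin n) (y : Heis n) :
    MemLp (Zbar lam j (primitiveKernel lam ε j y)) 2 (heisVol n) := by
  refine memLp_two_of_norm_le hn hlam hε
    (contDiff_Zbar lam j (contDiff_primitiveKernel hlam hε j y)).continuous y
    ((1 + 2 * n) ^ 2 * ε⁻¹) fun x => ?_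
  have h1 := mul_norm_sq_le_polar hlam hε.le x y j
  have hN : ε ≤ ‖polar lam x y + ε‖ := le_norm_add (polar_re_nonneg hlam x y) ε
  have hN0 : 0 < ‖polar lam x y + ε‖ := hε.trans_le hN
  rw [Zbar_primitiveKernel hlam hε, norm_mul, norm_mul, norm_inv, norm_inv, norm_pow,
    norm_polar_swap]
  have h2 : ‖polar lam y x + ε - 2 * n * (lam j * ((x.1 j - y.1 j) * conj (x.1 j - y.1 j)))‖ ≤
      (1 + 2 * n) * ‖polar lam x y + ε‖ := by
    refine (norm_sub_le _ _).trans ?_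
    rw [norm_polar_swap, norm_mul, norm_mul, norm_mul, norm_mul, RCLike.norm_conj,
      Complex.norm_real, Real.norm_of_nonneg (hlam j).le, ← sq]
    simp only [Complex.norm_ofNat, RCLike.norm_natCast]
    nlinarith [(n.cast_nonneg : (0 : ℝ) ≤ n)]
  set N := ‖polar lam x y + ε‖
  have h3 := inv_pow_le hε hN (2 * n + 1)
  calc _ ≤ ((N ^ (n + 1))⁻¹ * N⁻¹ * ((1 + 2 * n) * N)) ^ 2 := by gcongr
    _ = (1 + 2 * n) ^ 2 * (N ^ (2 * n + 1 + 1))⁻¹ := by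
        field_simp
        ring
    _ ≤ (1 + 2 * n) ^ 2 * (ε⁻¹ * (N ^ (2 * n + 1))⁻¹) := by gcongr
    _ = _ := by ring

/-! ### Weak CR functions and the reproducing identity -/

theorem IsTest.integral_fderiv {ψ : Heis n → ℂ} (hψ : IsTest ψ) (e : Heis n) :
    ∫ x, fderiv ℝ ψ x e ∂(heisVol n) = 0 := by
  have h1 : Integrable ψ (volume : Measure (Heis n)) :=
    hψ.1.continuous.integrable_of_hasCompactSupport hψ.2
  have h2 : Integrable (fun x => fderiv ℝ ψ x e) (volume : Measure (Heis n)) :=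
    (hψ.fderiv_apply e).1.continuous.integrable_of_hasCompactSupport (hψ.fderiv_apply e).2
  have h := integral_mul_fderiv_eq_neg_fderiv_mul_of_integrable (f := fun _ : Heis n => (1 : ℂ))
    (g := ψ) (v := e) (μ := (volume : Measure (Heis n))) (by simp)
    (by simpa using h2) (by simpa using h1) (fun x _ => differentiableAt_const _)
    (fun x _ => differentiableAt_of_contDiff hψ.1 x)
  rw [integral_smul_nnreal_measure]
  simp only [one_mul, fderiv_fun_const, Pi.zero_apply, zero_apply, zero_mul,
    integral_zero, neg_zero] at h
  rw [h, smul_zero]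

theorem IsTest.integral_Zbar {ψ : Heis n → ℂ} (hψ : IsTest ψ) (lam : Fin n → ℝ) (j : Fin n) :
    ∫ x, Zbar lam j ψ x ∂(heisVol n) = 0 := by
  have hint : ∀ {f : Heis n → ℂ}, IsTest f → Integrable f (heisVol n) := fun hf =>
    (hf.1.continuous.integrable_of_hasCompactSupport hf.2)
  have h1 := hψ.integral_fderiv (Pi.single j 1, 0)
  have h2 := hψ.integral_fderiv (Pi.single j Complex.I, 0)
  have h3 := (hψ.mul_left (contDiff_coord j)).integral_fderiv (0, 1)
  simp only [dt_coord_mul hψ] at h3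
  have i1 := hint (hψ.fderiv_apply (Pi.single j 1, 0))
  have i2 := hint (hψ.fderiv_apply (Pi.single j Complex.I, 0))
  have i3 := hint ((hψ.fderiv_apply (0, 1)).mul_left (contDiff_coord j))
  have e : ∀ x, Zbar lam j ψ x = ((1 / 2) * fderiv ℝ ψ x (Pi.single j 1, 0) +
      (1 / 2 * Complex.I) * fderiv ℝ ψ x (Pi.single j Complex.I, 0)) +
      (Complex.I * lam j) * (x.1 j * fderiv ℝ ψ x (0, 1)) := by
    intro x
    simp only [Zbar, dzbar, dt]
    ring
  simp only [e]
  rw [integral_add ((i1.const_mul _).fun_add (i2.const_mul _)) (i3.const_mul _),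
    integral_add (i1.const_mul _) (i2.const_mul _), integral_const_mul, integral_const_mul,
    integral_const_mul, h1, h2, h3]
  simp

/-- By the Leibniz rule `k · Z̄_j φ = Z̄_j(kφ)`, and `kφ` is again a test function. -/
theorem isWeakDbar_zero_of_Zbar_eq_zero {k : Heis n → ℂ} (hk : ContDiff ℝ ∞ k)
    (h : ∀ j x, Zbar lam j k x = 0) : IsWeakDbar lam k (fun _ => 0) := by
  intro j φ hφ
  have := (hφ.mul_left hk).integral_Zbar lam j
  have e : ∀ x, Zbar lam j (fun x => k x * φ x) x = k x * Zbar lam j φ x := by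
    intro x
    rw [Zbar_mul lam j (differentiableAt_of_contDiff hk x) (differentiableAt_of_contDiff hφ.1 x),
      h j x]
    ring
  simp only [e] at this
  simp [this]

/-- The unbounded coefficient `z_j` absorbs the factor `r` and becomes a coordinate of `r • x`. For
compactly supported `η` and bounded `r` the result is bounded uniformly in `x`, so isotropic cutoffs
suffice despite the growth of the vector field. -/
theorem Zbar_comp_smul {η : Heis n → ℂ} (hη : ContDiff ℝ ∞ η) (j : Fin n) (r : ℝ) (x : Heis n) :
    Zbar lam j (fun x => η (r • x)) x =
      r * dzbar j η (r • x) + Complex.I * lam j * ((r • x).1 j * dt η (r • x)) := by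
  have h := (differentiableAt_of_contDiff hη (r • x)).hasFDerivAt.comp x
    ((hasFDerivAt_id x).const_smul r)
  have h2 : HasFDerivAt (fun x => η (r • x)) _ x := h
  rw [Zbar_eq_of_hasFDerivAt lam j h2]
  simp [dzbar, dt]
  ring

theorem IsTest.dzbar {η : Heis n → ℂ} (hη : IsTest η) (j : Fin n) : IsTest (dzbar j η) :=
  ((hη.fderiv_apply _).add ((hη.fderiv_apply _).mul_left contDiff_const)).mul_left contDiff_const

theorem IsTest.exists_bound {η : Heis n → ℂ} (hη : IsTest η) : ∃ C : ℝ, ∀ x, ‖η x‖ ≤ C :=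
  hη.2.exists_bound_of_continuous hη.1.continuous

theorem exists_isTest_cutoff (n : ℕ) : ∃ η : Heis n → ℂ, IsTest η ∧ η 0 = 1 := by
  let χ : ContDiffBump (0 : Heis n) := ⟨1, 2, one_pos, one_lt_two⟩
  refine ⟨fun x => (χ x : ℂ), ⟨Complex.ofRealCLM.contDiff.comp χ.contDiff,
    χ.hasCompactSupport.comp_left (g := fun r : ℝ => (r : ℂ)) (by simp)⟩, ?_⟩
  have : χ 0 = 1 := χ.one_of_mem_closedBall (by simp [χ])
  simp [this]

/-- A weakly CR function in `L²` annihilates `Z̄_j φ` for every smooth `φ` with `φ` and `Z̄_j φ` in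
`L²`. -/
theorem IsWeakDbar.integral_mul_Zbar {f : Heis n → ℂ} (hf : MemLp f 2 (heisVol n))
    (h : IsWeakDbar lam f (fun _ => 0)) (j : Fin n) {φ : Heis n → ℂ} (hφ : ContDiff ℝ ∞ φ)
    (hφ2 : MemLp φ 2 (heisVol n)) (hZφ : MemLp (Zbar lam j φ) 2 (heisVol n)) :
    ∫ x, f x * Zbar lam j φ x ∂(heisVol n) = 0 := by
  obtain ⟨η, hη, hη0⟩ := exists_isTest_cutoff n
  have hdt : IsTest (fun x => x.1 j * dt η x) := (hη.fderiv_apply (0, 1)).mul_left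
    (contDiff_coord j)
  obtain ⟨C₀, hC₀⟩ := hη.exists_bound
  obtain ⟨C₁, hC₁⟩ := (hη.dzbar j).exists_bound
  obtain ⟨C₂, hC₂⟩ := hdt.exists_bound
  let r : ℕ → ℝ := fun m => 1 / ((m : ℝ) + 1)
  have hr0 : ∀ m, 0 < r m := fun m => by positivity
  have hr1 : ∀ m, r m ≤ 1 := fun m => by
    rw [div_le_one (by positivity)]
    linarith [(m.cast_nonneg : (0 : ℝ) ≤ m)]
  have hrt : Tendsto r atTop (𝓝 0) := tendsto_one_div_add_atTop_nhds_zero_nat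
  have hηr : ∀ m, ContDiff ℝ ∞ fun x => η (r m • x) := fun m =>
    hη.1.comp (contDiff_const_smul (r m))
  have htest : ∀ m, IsTest (fun x => η (r m • x) * φ x) := fun m =>
    ⟨(hηr m).mul hφ, (hη.2.comp_smul (hr0 m).ne').mul_right⟩
  have hZ : ∀ m x, Zbar lam j (fun x => η (r m • x) * φ x) x = η (r m • x) * Zbar lam j φ x +
      (r m * Heisenberg.dzbar j η (r m • x) +
        Complex.I * lam j * ((r m • x).1 j * dt η (r m • x))) * φ x := by
    intro m x
    rw [Zbar_mul lam j (differentiableAt_of_contDiff (hηr m) x)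
      (differentiableAt_of_contDiff hφ x), Zbar_comp_smul hη.1]
  have hzero : ∀ m, ∫ x, f x * Zbar lam j (fun x => η (r m • x) * φ x) x ∂(heisVol n) = 0 := by
    intro m
    have := h j _ (htest m)
    simpa [eq_comm] using this
  have i1 : Integrable (fun x => f x * φ x) (heisVol n) := hf.integrable_mul hφ2
  have i2 : Integrable (fun x => f x * Zbar lam j φ x) (heisVol n) := hf.integrable_mul hZφ
  have hlim := tendsto_integral_of_dominated_convergence (μ := heisVol n)
    (F := fun m x => f x * Zbar lam j (fun x => η (r m • x) * φ x) x)
    (f := fun x => f x * Zbar lam j φ x)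
    (fun x => C₀ * ‖f x * Zbar lam j φ x‖ + (C₁ + |lam j| * C₂) * ‖f x * φ x‖)
    (fun m => hf.1.mul (contDiff_Zbar lam j (htest m).1).continuous.aestronglyMeasurable)
    ((i2.norm.const_mul _).add (i1.norm.const_mul _)) ?_ ?_
  · simp only [hzero] at hlim
    exact (tendsto_nhds_unique hlim tendsto_const_nhds)
  · refine fun m => ae_of_all _ fun x => ?_
    simp only [hZ]
    have b1 : ‖(r m : ℂ) * Heisenberg.dzbar j η (r m • x) +
        Complex.I * lam j * ((r m • x).1 j * dt η (r m • x))‖ ≤ C₁ + |lam j| * C₂ := by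
      refine (norm_add_le _ _).trans ?_
      rw [norm_mul, norm_mul, norm_mul, Complex.norm_I, one_mul, Complex.norm_real,
        Complex.norm_real, Real.norm_eq_abs, Real.norm_eq_abs, abs_of_pos (hr0 m)]
      refine add_le_add ?_ (mul_le_mul_of_nonneg_left (hC₂ _) (abs_nonneg _))
      calc r m * ‖Heisenberg.dzbar j η (r m • x)‖ ≤ 1 * ‖Heisenberg.dzbar j η (r m • x)‖ := by
            gcongr
            exact hr1 m
        _ ≤ C₁ := by
            rw [one_mul]
            exact hC₁ _
    rw [mul_add]
    refine (norm_add_le _ _).trans (add_le_add ?_ ?_)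
    · rw [norm_mul, norm_mul, norm_mul]
      have := mul_le_mul_of_nonneg_right (hC₀ (r m • x))
        (mul_nonneg (norm_nonneg (f x)) (norm_nonneg (Zbar lam j φ x)))
      linarith
    · rw [norm_mul, norm_mul, norm_mul]
      have := mul_le_mul_of_nonneg_right b1
        (mul_nonneg (norm_nonneg (f x)) (norm_nonneg (φ x)))
      linarith
  · refine ae_of_all _ fun x => ?_
    simp only [hZ]
    have hrx : Tendsto (fun m => r m • x) atTop (𝓝 0) := by
      simpa using hrt.smul_const x
    have t1 : Tendsto (fun m => η (r m • x)) atTop (𝓝 1) := by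
      rw [← hη0]
      exact (hη.1.continuous.tendsto 0).comp hrx
    have t2 := ((hη.dzbar j).1.continuous.tendsto 0).comp hrx
    -- This limit is zero because the factor `x.1 j` vanishes at the origin.
    have t3 := (hdt.1.continuous.tendsto 0).comp hrx
    have t4 : Tendsto (fun m => (r m : ℂ)) atTop (𝓝 0) := by
      exact_mod_cast (Complex.continuous_ofReal.tendsto 0).comp hrt
    have t5 := tendsto_const_nhds (x := f x) (f := atTop (α := ℕ)) |>.mul
      ((t1.mul_const (Zbar lam j φ x)).add
      (((t4.mul t2).add (t3.const_mul (Complex.I * lam j))).mul_const (φ x)))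
    simpa using t5

/-- The approximate identity kernel which agrees with the Szegő kernel on CR functions. -/
def poissonKernel (lam : Fin n → ℝ) (ε : ℝ) (v : Heis n) : ℂ :=
  2 * ε * ((conj (gauge lam v) + ε) ^ (n + 1))⁻¹ * (gauge lam v + ε)⁻¹

theorem continuous_poissonKernel (hlam : ∀ j, 0 < lam j) {ε : ℝ} (hε : 0 < ε) :
    Continuous (poissonKernel lam ε) := by
  have h := continuous_gauge lam
  refine (continuous_const.mul (Continuous.inv₀ (by fun_prop) fun v => ?_)).mul
    (Continuous.inv₀ (by fun_prop) fun v => add_pos_ne_zero (gauge_re_nonneg hlam v) hε)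
  refine pow_ne_zero _ (add_pos_ne_zero ?_ hε)
  rw [Complex.conj_re]
  exact gauge_re_nonneg hlam v

theorem norm_poissonKernel (lam : Fin n → ℝ) {ε : ℝ} (hε : 0 < ε) (v : Heis n) :
    ‖poissonKernel lam ε v‖ = 2 * ε * (‖gauge lam v + ε‖ ^ (n + 2))⁻¹ := by
  have : ‖conj (gauge lam v) + ε‖ = ‖gauge lam v + ε‖ := by
    rw [← RCLike.norm_conj (gauge lam v + ε), map_add, Complex.conj_ofReal]
  rw [poissonKernel, norm_mul, norm_mul, norm_mul, norm_inv, norm_inv, norm_pow, this,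
    Complex.norm_real, Real.norm_of_nonneg hε.le, Complex.norm_ofNat, mul_assoc, ← mul_inv,
    ← pow_succ]

theorem integrable_poissonKernel (hlam : ∀ j, 0 < lam j) {ε : ℝ} (hε : 0 < ε) :
    Integrable (poissonKernel lam ε) (heisVol n) := by
  refine ((integrable_gauge_critical hlam hε).const_mul (2 * ε)).mono'
    (continuous_poissonKernel hlam hε).aestronglyMeasurable (ae_of_all _ fun v => ?_)
  rw [norm_poissonKernel lam hε]

/-- The `n + 2` inverse factors scale by `r^{-2}` each and the prefactor `ε` by `r²`. The outcome
`r^{-(2n+2)}` matches the Jacobian, so the total mass does not depend on `ε`. -/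
theorem poissonKernel_dil (lam : Fin n → ℝ) {r : ℝ} (hr : 0 < r) (v : Heis n) :
    poissonKernel lam (r ^ 2) (dil r v) = ((r ^ (2 * n + 2))⁻¹ : ℝ) • poissonKernel lam 1 v := by
  have hr' : (r : ℂ) ≠ 0 := Complex.ofReal_ne_zero.2 hr.ne'
  have e1 : conj (gauge lam (dil r v)) + ((r ^ 2 : ℝ) : ℂ) =
      r ^ 2 * (conj (gauge lam v) + 1) := by
    rw [gauge_dil]
    simp
    ring
  have e2 : gauge lam (dil r v) + ((r ^ 2 : ℝ) : ℂ) = r ^ 2 * (gauge lam v + 1) := by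
    rw [gauge_dil]
    push_cast
    ring
  rw [poissonKernel, e1, e2, poissonKernel, Complex.real_smul]
  push_cast
  rw [mul_pow, mul_inv, mul_inv, show (r : ℂ) ^ (2 * n + 2) = (r ^ 2) ^ (n + 1) by ring]
  field_simp

theorem IsWeakDbar.integral_mul_szegoKernel (hn : 1 ≤ n) (hlam : ∀ j, 0 < lam j) {f : Heis n → ℂ}
    (hf : MemLp f 2 (heisVol n)) (h : IsWeakDbar lam f (fun _ => 0)) {ε : ℝ} (hε : 0 < ε)
    (y : Heis n) :
    ∫ x, f x * szegoKernel lam ε y x ∂(heisVol n) =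
      ∫ v, f (mul lam y v) * poissonKernel lam ε v ∂(heisVol n) := by
  have hk : MemLp (fun x => szegoKernel lam ε y x) 2 (heisVol n) := by
    have := (memLp_szegoKernel hn hlam hε y).star
    refine this.ae_eq (ae_of_all _ fun x => ?_)
    simpa using conj_szegoKernel lam ε x y
  have hsum : ∫ x, f x * ∑ j, Zbar lam j (primitiveKernel lam ε j y) x ∂(heisVol n) = 0 := by
    simp only [Finset.mul_sum]
    have hint : ∀ j, Integrable (fun x => f x * Zbar lam j (primitiveKernel lam ε j y) x)
        (heisVol n) := fun j => hf.integrable_mul (memLp_Zbar_primitiveKernel hn hlam hε j y)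
    rw [integral_finsetSum _ fun j _ => hint j]
    exact Finset.sum_eq_zero fun j _ => h.integral_mul_Zbar hf j
      (contDiff_primitiveKernel hlam hε j y) (memLp_primitiveKernel hn hlam hε j y)
      (memLp_Zbar_primitiveKernel hn hlam hε j y)
  have hZint : Integrable (fun x => f x * ∑ j, Zbar lam j (primitiveKernel lam ε j y) x)
      (heisVol n) :=
    hf.integrable_mul (memLp_finsetSum _ fun j _ => memLp_Zbar_primitiveKernel hn hlam hε j y)
  have hkint : Integrable (fun x => f x * szegoKernel lam ε y x) (heisVol n) :=
    hf.integrable_mul hk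
  have hn0 : (n : ℂ) ≠ 0 := Nat.cast_ne_zero.2 (by omega)
  -- Adding `1/n` times the vanishing pairing of `f` with the divergence changes the kernel but not
  -- the integral; this needs `n ≠ 0`.
  rw [← add_zero (∫ x, f x * szegoKernel lam ε y x ∂(heisVol n)), ← mul_zero (n : ℂ)⁻¹, ← hsum,
    ← integral_const_mul, ← integral_add hkint (hZint.const_mul _),
    ← integral_mul_left lam y]
  refine integral_congr_ae (ae_of_all _ fun v => ?_)
  simp only [sum_Zbar_primitiveKernel hlam hε]
  rw [poissonKernel, ← polar_mul_left lam y v, conj_polar]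
  field_simp
  ring

/-- On test functions, the regularized kernel may be applied after the Szegő projection. -/
theorem integral_szegoKernel_eq (hn : 1 ≤ n) (hlam : ∀ j, 0 < lam j) {φ : Heis n → ℂ}
    (hφ : IsTest φ) {ε : ℝ} (hε : 0 < ε) (y : Heis n) :
    ∫ x, szegoKernel lam ε y x * φ x ∂(heisVol n) =
      ∫ v, szegoProjection lam (hφ.memLp.toLp φ) (mul lam y v) * poissonKernel lam ε v
        ∂(heisVol n) := by
  have hK := memLp_szegoKernel hn hlam hε y
  set K : L2Fun n := hK.toLp _
  have hKmem : K ∈ kerKohn lam := mem_kerKohn_iff.2 (isWeakDbar_congr lam hK.coeFn_toLp.symm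
    (ae_eq_refl _) (isWeakDbar_zero_of_Zbar_eq_zero (contDiff_szegoKernel hlam hε y)
      fun j x => Zbar_szegoKernel hlam hε j x y))
  have hin : ∀ g : L2Fun n, ⟪K, g⟫_ℂ = ∫ x, g x * szegoKernel lam ε y x ∂(heisVol n) := by
    intro g
    rw [L2.inner_def]
    refine integral_congr_ae ?_
    filter_upwards [hK.coeFn_toLp] with x hx
    rw [hx, RCLike.inner_apply, conj_szegoKernel]
  have hmem : szegoProjection lam (hφ.memLp.toLp φ) ∈ kerKohn lam :=
    (kerKohn lam).starProjection_apply_mem _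
  -- The projection is self-adjoint and fixes `K`.
  have h1 : ⟪K, szegoProjection lam (hφ.memLp.toLp φ)⟫_ℂ = ⟪K, hφ.memLp.toLp φ⟫_ℂ := by
    rw [szegoProjection, ← Submodule.inner_starProjection_left_eq_right,
      Submodule.starProjection_eq_self_iff.2 hKmem]
  rw [← (mem_kerKohn_iff.1 hmem).integral_mul_szegoKernel hn hlam (Lp.memLp _) hε y, ← hin, h1,
    hin]
  refine integral_congr_ae ?_
  filter_upwards [hφ.memLp.coeFn_toLp] with x hx
  rw [hx, mul_comm]

/-! ### The limit of the regularized integrals -/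

/-- A primitive of the logarithm. -/
def logPrimitive (a : ℂ) : ℂ := a * Complex.log a - a

theorem norm_mul_log_le (a : ℂ) :
    ‖a * Complex.log a‖ ≤ |‖a‖ * Real.log ‖a‖| + Real.pi * ‖a‖ := by
  have h : ‖Complex.log a‖ ≤ |Real.log ‖a‖| + Real.pi := by
    refine (Complex.norm_le_abs_re_add_abs_im _).trans ?_
    rw [Complex.log_re, Complex.log_im]
    gcongr
    exact Complex.abs_arg_le_pi a
  rw [norm_mul, abs_mul, abs_norm]
  calc ‖a‖ * ‖Complex.log a‖ ≤ ‖a‖ * (|Real.log ‖a‖| + Real.pi) := by gcongr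
    _ = _ := by ring

/-- The closed right half-plane meets the branch cut of `log` only at `0`, where the factor `a`
kills the singularity. -/
theorem continuousOn_logPrimitive : ContinuousOn logPrimitive {a | 0 ≤ a.re} := by
  intro a ha
  rcases eq_or_ne a 0 with rfl | h0
  · have h1 : Tendsto (fun a : ℂ => |‖a‖ * Real.log ‖a‖| + Real.pi * ‖a‖) (𝓝 0) (𝓝 0) := by
      have : Continuous fun a : ℂ => |‖a‖ * Real.log ‖a‖| + Real.pi * ‖a‖ :=
        ((Real.continuous_mul_log.comp continuous_norm).abs).add
          (continuous_const.mul continuous_norm)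
      simpa using this.tendsto 0
    have h2 : Tendsto (fun a : ℂ => a * Complex.log a) (𝓝 0) (𝓝 0) :=
      squeeze_zero_norm norm_mul_log_le h1
    have h3 : ContinuousAt logPrimitive 0 := by
      have := h2.sub (tendsto_id (x := 𝓝 (0 : ℂ)))
      simp only [id, sub_zero] at this
      rw [ContinuousAt, show logPrimitive 0 = 0 by simp [logPrimitive]]
      exact this
    exact h3.continuousWithinAt
  · have hs : a ∈ Complex.slitPlane := by
      rw [Complex.mem_slitPlane_iff]
      have ha' : 0 ≤ a.re := ha
      rcases ha'.lt_or_eq with h | h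
      · exact Or.inl h
      · exact Or.inr fun him => h0 (Complex.ext h.symm him)
    exact ((continuousAt_id.mul (continuousAt_clog hs)).sub continuousAt_id).continuousWithinAt

theorem hasDerivAt_logPrimitive {a : ℂ} (ha : 0 < a.re) :
    HasDerivAt logPrimitive (Complex.log a) a := by
  have hs : a ∈ Complex.slitPlane := Complex.mem_slitPlane_iff.2 (Or.inl ha)
  have h0 : a ≠ 0 := Complex.slitPlane_ne_zero hs
  convert! ((hasDerivAt_id' a).mul (Complex.hasDerivAt_log hs)).sub (hasDerivAt_id' a) using 1
  field_simp
  ring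

theorem polar_add_re_pos (hlam : ∀ j, 0 < lam j) {ε : ℝ} (hε : 0 < ε) (x y : Heis n) :
    0 < (polar lam x y + ε).re := by
  rw [Complex.add_re, Complex.ofReal_re]
  linarith [polar_re_nonneg hlam x y]

theorem fderiv_polar_right_time (lam : Fin n → ℝ) (x y : Heis n) :
    fderiv ℝ (fun y => polar lam x y) y (0, 1) = -Complex.I := by
  have hd := differentiableAt_of_contDiff (contDiff_polar_right lam x) y
  have h := hd.lineDeriv_eq_fderiv (v := ((0, 1) : Heis n))
  rw [← h]
  have : ∀ s : ℝ, polar lam x (y + s • ((0, 1) : Heis n)) = polar lam x y + (-Complex.I) * s := by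
    intro s
    simp [polar]
    ring
  rw [lineDeriv]
  simp only [this]
  have h2 : HasDerivAt (fun s : ℝ => polar lam x y + (-Complex.I) * (s : ℂ)) (-Complex.I) 0 := by
    simpa using ((Complex.ofRealCLM.hasDerivAt (x := (0 : ℝ))).const_mul (-Complex.I)).const_add
      (polar lam x y)
  exact h2.deriv

/-- `polar lam x y` has derivative `-i` in the time variable of `y`, so `g'` is `i` times a
`t`-derivative, which moves onto `u`. -/
theorem integral_deriv_polar_mul (hlam : ∀ j, 0 < lam j) {g g' : ℂ → ℂ}
    (hg : ∀ a : ℂ, 0 < a.re → HasDerivAt g (g' a) a) (hg' : ContinuousOn g' {a | 0 < a.re})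
    {ε : ℝ} (hε : 0 < ε) (x : Heis n) {u : Heis n → ℂ} (hu : IsTest u) :
    ∫ y, g' (polar lam x y + ε) * u y ∂(heisVol n) =
      -Complex.I * ∫ y, g (polar lam x y + ε) * dt u y ∂(heisVol n) := by
  have hpos := polar_add_re_pos hlam hε x
  have hp := fun y => differentiableAt_of_contDiff (contDiff_polar_right lam x) y
  have hd : ∀ y, HasFDerivAt (fun y => g (polar lam x y + ε)) _ y := fun y =>
    HasFDerivAt.comp y ((hg _ (hpos y)).hasFDerivAt.restrictScalars ℝ)
      ((hp y).hasFDerivAt.add_const (ε : ℂ))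
  have hdt : ∀ y, fderiv ℝ (fun y => g (polar lam x y + ε)) y (0, 1) =
      -Complex.I * g' (polar lam x y + ε) := by
    intro y
    rw [(hd y).fderiv]
    simp [fderiv_polar_right_time, mul_comm]
  have c0 : Continuous fun y => polar lam x y + ε :=
    (contDiff_polar_right lam x).continuous.add continuous_const
  have c1 : Continuous fun y => g (polar lam x y + ε) :=
    continuous_iff_continuousAt.2 fun y => (hd y).continuousAt
  have c2 : Continuous fun y => g' (polar lam x y + ε) := hg'.comp_continuous c0 hpos
  have hint : ∀ {f v : Heis n → ℂ}, Continuous f → IsTest v →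
      Integrable (fun y => f y * v y) (volume : Measure (Heis n)) := fun hf hv =>
    (hf.mul hv.1.continuous).integrable_of_hasCompactSupport hv.2.mul_left
  have h := integral_mul_fderiv_eq_neg_fderiv_mul_of_integrable
    (f := fun y => g (polar lam x y + ε)) (g := u) (v := ((0, 1) : Heis n))
    (μ := (volume : Measure (Heis n)))
    (by simp only [hdt]; exact hint (continuous_const.mul c2) hu)
    (hint c1 (hu.fderiv_apply _)) (hint c1 hu) (fun y _ => (hd y).differentiableAt)
    (fun y _ => differentiableAt_of_contDiff hu.1 y)
  simp only [hdt, mul_assoc, integral_const_mul] at h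
  rw [integral_smul_nnreal_measure, integral_smul_nnreal_measure]
  simp only [dt]
  rw [h, mul_smul_comm]
  congr 1
  linear_combination (∫ y, g' (polar lam x y + ε) * u y) * Complex.I_sq

theorem IsTest.dt {u : Heis n → ℂ} (hu : IsTest u) : IsTest (dt u) := hu.fderiv_apply _

theorem IsTest.iterate_dt {u : Heis n → ℂ} (hu : IsTest u) (m : ℕ) :
    IsTest (Heisenberg.dt^[m] u) := by
  induction m generalizing u with
  | zero => exact hu
  | succ m ih => exact ih hu.dt

/-- It takes `m` steps to lower the power to `1/a`, one to reach `log` and one more for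
`logPrimitive`. The constant must not depend on `ε` or `x`, so that continuity up to `ε = 0` can be
read off the right-hand side. -/
theorem exists_integral_inv_pow_polar_mul (hlam : ∀ j, 0 < lam j) (m : ℕ) :
    ∃ C : ℂ, ∀ (ε : ℝ), 0 < ε → ∀ (x : Heis n) (u : Heis n → ℂ), IsTest u →
      ∫ y, ((polar lam x y + ε) ^ (m + 1))⁻¹ * u y ∂(heisVol n) =
        C * ∫ y, logPrimitive (polar lam x y + ε) * dt^[m + 2] u y ∂(heisVol n) := by
  have hne : ∀ a : ℂ, 0 < a.re → a ≠ 0 := fun a ha h => by simp [h] at ha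
  induction m with
  | zero =>
    refine ⟨-Complex.I * -Complex.I, fun ε hε x u hu => ?_⟩
    have h1 := integral_deriv_polar_mul hlam (g := Complex.log) (g' := fun a => a⁻¹)
      (fun a ha => Complex.hasDerivAt_log (Complex.mem_slitPlane_iff.2 (Or.inl ha)))
      (continuousOn_inv₀.mono fun a ha => hne a ha) hε x hu
    have h2 := integral_deriv_polar_mul hlam (g := logPrimitive) (g' := Complex.log)
      (fun a ha => hasDerivAt_logPrimitive ha)
      (fun a ha => (continuousAt_clog
        (Complex.mem_slitPlane_iff.2 (Or.inl ha))).continuousWithinAt) hε x hu.dt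
    simp only [zero_add, pow_one]
    rw [h1, h2, ← mul_assoc]
    rfl
  | succ m ih =>
    obtain ⟨C, hC⟩ := ih
    refine ⟨(-(m + 1 : ℂ))⁻¹ * (-Complex.I * C), fun ε hε x u hu => ?_⟩
    have hm : (m + 1 : ℂ) ≠ 0 := Nat.cast_add_one_ne_zero m
    have h1 := integral_deriv_polar_mul hlam (g := fun a => (a ^ (m + 1))⁻¹)
      (g' := fun a => -(m + 1 : ℂ) * (a ^ (m + 1 + 1))⁻¹) ?_ ?_ hε x hu
    · simp only [mul_assoc, integral_const_mul] at h1
      rw [hC ε hε x _ hu.dt] at h1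
      rw [mul_assoc, mul_assoc, eq_inv_mul_iff_mul_eq₀ (neg_ne_zero.2 hm)]
      exact h1
    · intro a ha
      have h0 := hne a ha
      convert! ((hasDerivAt_id' a).fun_pow (m + 1)).inv (pow_ne_zero _ h0) using 1
      simp only [Nat.add_sub_cancel]
      push_cast
      field_simp
      ring
    · exact continuousOn_const.mul ((continuousOn_pow _).inv₀ fun a ha => pow_ne_zero _ (hne a ha))

/-- The regularized integrals of a test function extend continuously to `ε = 0`. -/
theorem exists_continuous_extension (hlam : ∀ j, 0 < lam j) {u : Heis n → ℂ} (hu : IsTest u) :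
    ∃ H : ℝ × Heis n → ℂ, Continuous H ∧ ∀ ε : ℝ, 0 < ε → ∀ x,
      ∫ y, szegoKernel lam ε x y * u y ∂(heisVol n) = H (ε, x) := by
  obtain ⟨C, hC⟩ := exists_integral_inv_pow_polar_mul hlam n
  -- Using `|ε|` keeps the argument in the closed right half-plane for every real `ε`, so that the
  -- extension is continuous everywhere.
  refine ⟨fun p => C * ∫ y, logPrimitive (polar lam p.2 y + (|p.1| : ℝ)) * dt^[n + 2] u y
    ∂(heisVol n), ?_, fun ε hε x => ?_⟩
  · refine continuous_const.mul ?_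
    have hv := hu.iterate_dt (n + 2)
    have hc : Continuous fun q : (ℝ × Heis n) × Heis n =>
        logPrimitive (polar lam q.1.2 q.2 + (|q.1.1| : ℝ)) := by
      refine continuousOn_logPrimitive.comp_continuous (((continuous_polar lam).comp
        (by fun_prop : Continuous fun q : (ℝ × Heis n) × Heis n => (q.1.2, q.2))).add
        (by fun_prop)) fun q => ?_
      have := polar_re_nonneg hlam q.1.2 q.2
      simp only [Set.mem_ofPred_eq, Complex.add_re, Complex.ofReal_re]
      positivity
    rw [← continuousOn_univ]
    refine continuousOn_integral_of_compact_support (k := tsupport (dt^[n + 2] u)) hv.2 ?_ ?_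
    · exact (hc.mul (hv.1.continuous.comp continuous_snd)).continuousOn
    · intro p y _ hy
      rw [image_eq_zero_of_notMem_tsupport hy, mul_zero]
  · simp only [szegoKernel, hC ε hε x u hu, abs_of_pos hε]

/-! ### The mass of the approximate identity -/

theorem sub_I_mul_ne_zero {a : ℝ} (ha : 0 < a) (t : ℝ) : (a : ℂ) - Complex.I * t ≠ 0 := by
  intro h
  have := congrArg Complex.re h
  simp at this
  exact ha.ne' this

theorem add_I_mul_ne_zero {a : ℝ} (ha : 0 < a) (t : ℝ) : (a : ℂ) + Complex.I * t ≠ 0 := by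
  simpa using sub_I_mul_ne_zero ha (-t)

theorem sub_I_mul_mul_add (a t : ℝ) :
    ((a : ℂ) - Complex.I * t) * (a + Complex.I * t) = ((a ^ 2 + t ^ 2 : ℝ) : ℂ) := by
  push_cast
  linear_combination (-(t : ℂ) ^ 2) * Complex.I_sq

theorem norm_sub_I_mul_sq (a t : ℝ) : ‖(a : ℂ) - Complex.I * t‖ ^ 2 = a ^ 2 + t ^ 2 := by
  rw [← Complex.normSq_eq_norm_sq, Complex.normSq_apply]
  simp
  ring

theorem integrable_inv_sq_add_sq {a : ℝ} (ha : 0 < a) :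
    Integrable fun t : ℝ => (a ^ 2 + t ^ 2)⁻¹ := by
  have h := (integrable_inv_one_add_sq.comp_mul_left' (inv_ne_zero ha.ne')).const_mul (a ^ 2)⁻¹
  refine h.congr (ae_of_all _ fun t => ?_)
  simp only
  rw [← mul_inv]
  congr 1
  field_simp

theorem integral_inv_sq_add_sq {a : ℝ} (ha : 0 < a) :
    ∫ t : ℝ, (a ^ 2 + t ^ 2)⁻¹ = Real.pi / a := by
  have h := Measure.integral_comp_mul_left (fun t : ℝ => (1 + t ^ 2)⁻¹) a⁻¹
  rw [integral_univ_inv_one_add_sq, inv_inv, abs_of_pos ha, smul_eq_mul] at h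
  have e : ∀ t : ℝ, (a ^ 2 + t ^ 2)⁻¹ = (a ^ 2)⁻¹ * (1 + (a⁻¹ * t) ^ 2)⁻¹ := by
    intro t
    rw [← mul_inv]
    congr 1
    field_simp
  simp only [e]
  rw [integral_const_mul, h]
  field_simp

theorem continuous_inv_pow_sub_I_mul {a : ℝ} (ha : 0 < a) (m : ℕ) :
    Continuous fun t : ℝ => (((a : ℂ) - Complex.I * t) ^ m)⁻¹ :=
  Continuous.inv₀ (by fun_prop) fun t => pow_ne_zero _ (sub_I_mul_ne_zero ha t)

theorem norm_inv_pow_sub_I_mul_le {a : ℝ} (ha : 0 < a) (m : ℕ) (t : ℝ) :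
    ‖(((a : ℂ) - Complex.I * t) ^ (m + 2))⁻¹‖ ≤ (a ^ m)⁻¹ * (a ^ 2 + t ^ 2)⁻¹ := by
  have h : a ≤ ‖(a : ℂ) - Complex.I * t‖ := by
    have := Complex.re_le_norm ((a : ℂ) - Complex.I * t)
    simpa using this
  rw [norm_inv, norm_pow, pow_add, norm_sub_I_mul_sq, mul_inv]
  gcongr

/-- The integrand has an explicit primitive, a multiple of `(a - it)^{-(m+1)}`, that vanishes at
both ends. -/
theorem integral_inv_pow_sub_I_mul {a : ℝ} (ha : 0 < a) (m : ℕ) :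
    ∫ t : ℝ, (((a : ℂ) - Complex.I * t) ^ (m + 2))⁻¹ = 0 := by
  have hd : ∀ t : ℝ, HasDerivAt
      (fun t : ℝ => ((m + 1 : ℂ) * Complex.I)⁻¹ * (((a : ℂ) - Complex.I * t) ^ (m + 1))⁻¹)
      ((((a : ℂ) - Complex.I * t) ^ (m + 2))⁻¹) t := by
    intro t
    have hm : (m + 1 : ℂ) ≠ 0 := Nat.cast_add_one_ne_zero m
    have h0 := sub_I_mul_ne_zero ha t
    have h1 : HasDerivAt (fun t : ℝ => (a : ℂ) - Complex.I * t) (-Complex.I) t := by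
      simpa using ((Complex.ofRealCLM.hasDerivAt (x := t)).const_mul Complex.I).const_sub (a : ℂ)
    convert! ((h1.fun_pow (m + 1)).inv (pow_ne_zero _ h0)).const_mul
      ((m + 1 : ℂ) * Complex.I)⁻¹ using 1
    have hI := Complex.I_ne_zero
    simp only [Nat.add_sub_cancel]
    push_cast
    field_simp
    ring
  have hint : Integrable fun t : ℝ => (((a : ℂ) - Complex.I * t) ^ (m + 2))⁻¹ :=
    ((integrable_inv_sq_add_sq ha).const_mul (a ^ m)⁻¹).mono'
      (continuous_inv_pow_sub_I_mul ha _).aestronglyMeasurable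
      (ae_of_all _ (norm_inv_pow_sub_I_mul_le ha m))
  have hnorm : ∀ t : ℝ, |t| ≤ ‖(a : ℂ) - Complex.I * t‖ := fun t => by
    have := Complex.abs_im_le_norm ((a : ℂ) - Complex.I * t)
    simpa using this
  have hlim : ∀ l : Filter ℝ, Tendsto (fun t : ℝ => |t|) l atTop → Tendsto
      (fun t : ℝ => ((m + 1 : ℂ) * Complex.I)⁻¹ * (((a : ℂ) - Complex.I * t) ^ (m + 1))⁻¹)
      l (𝓝 0) := by
    intro l hl
    have h1 : Tendsto (fun t : ℝ => ‖(a : ℂ) - Complex.I * t‖ ^ (m + 1)) l atTop :=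
      (tendsto_pow_atTop (Nat.succ_ne_zero m)).comp (tendsto_atTop_mono hnorm hl)
    have h2 : Tendsto (fun t : ℝ => (((a : ℂ) - Complex.I * t) ^ (m + 1))⁻¹) l (𝓝 0) := by
      rw [tendsto_zero_iff_norm_tendsto_zero]
      simp only [norm_inv, norm_pow]
      exact h1.inv_tendsto_atTop
    simpa using h2.const_mul (((m + 1 : ℂ) * Complex.I)⁻¹)
  simpa using integral_of_hasDerivAt_of_tendsto hd hint (hlim _ tendsto_abs_atBot_atTop)
    (hlim _ tendsto_abs_atTop_atTop)

theorem integrable_inv_pow_mul_inv {a : ℝ} (ha : 0 < a) (m : ℕ) :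
    Integrable fun t : ℝ =>
      (((a : ℂ) - Complex.I * t) ^ (m + 1))⁻¹ * ((a : ℂ) + Complex.I * t)⁻¹ := by
  refine ((integrable_inv_sq_add_sq ha).const_mul (a ^ m)⁻¹).mono'
    ((continuous_inv_pow_sub_I_mul ha _).mul (Continuous.inv₀ (by fun_prop)
      (add_I_mul_ne_zero ha))).aestronglyMeasurable (ae_of_all _ fun t => ?_)
  have h : ‖(a : ℂ) + Complex.I * t‖ = ‖(a : ℂ) - Complex.I * t‖ := by
    rw [← RCLike.norm_conj]
    simp [sub_eq_add_neg]
  rw [norm_mul, norm_inv ((a : ℂ) + _), h, ← norm_inv, ← norm_mul, ← mul_inv, ← pow_succ]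
  exact norm_inv_pow_sub_I_mul_le ha m t

/-- The residue at one pole, obtained by induction instead: partial fractions lower the power by one
at the price of a factor `1/(2a)` and a pure power of `a - it`, whose integral is zero. -/
theorem integral_inv_pow_mul_inv {a : ℝ} (ha : 0 < a) (m : ℕ) :
    ∫ t : ℝ, (((a : ℂ) - Complex.I * t) ^ (m + 1))⁻¹ * ((a : ℂ) + Complex.I * t)⁻¹ =
      ((2 * Real.pi * ((2 * a) ^ (m + 1))⁻¹ : ℝ) : ℂ) := by
  have ha' : (a : ℂ) ≠ 0 := Complex.ofReal_ne_zero.2 ha.ne'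
  induction m with
  | zero =>
    have e : ∀ t : ℝ, (((a : ℂ) - Complex.I * t) ^ (0 + 1))⁻¹ * ((a : ℂ) + Complex.I * t)⁻¹ =
        (((a ^ 2 + t ^ 2)⁻¹ : ℝ) : ℂ) := by
      intro t
      rw [zero_add, pow_one, ← mul_inv, sub_I_mul_mul_add, Complex.ofReal_inv]
    simp only [e]
    rw [integral_complex_ofReal, integral_inv_sq_add_sq ha, zero_add, pow_one]
    congr 1
    field_simp
  | succ m ih =>
    have hint : Integrable fun t : ℝ => (((a : ℂ) - Complex.I * t) ^ (m + 2))⁻¹ :=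
      ((integrable_inv_sq_add_sq ha).const_mul (a ^ m)⁻¹).mono'
        (continuous_inv_pow_sub_I_mul ha _).aestronglyMeasurable
        (ae_of_all _ (norm_inv_pow_sub_I_mul_le ha m))
    have e : ∀ t : ℝ, (((a : ℂ) - Complex.I * t) ^ (m + 1 + 1))⁻¹ * ((a : ℂ) + Complex.I * t)⁻¹ =
        (2 * a : ℂ)⁻¹ * ((((a : ℂ) - Complex.I * t) ^ (m + 1))⁻¹ * ((a : ℂ) + Complex.I * t)⁻¹ +
          (((a : ℂ) - Complex.I * t) ^ (m + 2))⁻¹) := by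
      intro t
      have h1 := sub_I_mul_ne_zero ha t
      have h2 := add_I_mul_ne_zero ha t
      field_simp
      ring
    simp only [e]
    rw [integral_const_mul, integral_add (integrable_inv_pow_mul_inv ha m) hint, ih,
      integral_inv_pow_sub_I_mul ha, add_zero]
    push_cast
    rw [pow_succ (2 * (a : ℂ)) (m + 1), mul_inv]
    ring

/-! ### Gaussian integrals over `ℂⁿ` and the total mass. -/

theorem integral_complex_gaussian {b : ℝ} (hb : 0 < b) :
    ∫ z : ℂ, Real.exp (-(b * ‖z‖ ^ 2)) = Real.pi / b := by
  have := GaussianFourier.integral_rexp_neg_mul_sq_norm (V := ℂ) hb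
  simpa using this

theorem exp_neg_sum (lam : Fin n → ℝ) (r : ℝ) (w : Fin n → ℂ) :
    Real.exp (-(r * ∑ j, lam j * ‖w j‖ ^ 2)) = ∏ j, Real.exp (-(r * lam j * ‖w j‖ ^ 2)) := by
  rw [← Real.exp_sum, Finset.sum_neg_distrib, Finset.mul_sum]
  simp only [mul_assoc]

theorem integral_exp_neg_sum (hlam : ∀ j, 0 < lam j) {r : ℝ} (hr : 0 < r) :
    ∫ w : Fin n → ℂ, Real.exp (-(r * ∑ j, lam j * ‖w j‖ ^ 2)) =
      Real.pi ^ n / (r ^ n * ∏ j, lam j) := by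
  simp only [exp_neg_sum]
  rw [integral_fintype_prod_volume_eq_prod (fun j (z : ℂ) => Real.exp (-(r * lam j * ‖z‖ ^ 2)))]
  simp only [integral_complex_gaussian (mul_pos hr (hlam _))]
  simp [Finset.prod_div_distrib, Finset.prod_mul_distrib]

theorem integrable_exp_neg_sum (hlam : ∀ j, 0 < lam j) {r : ℝ} (hr : 0 < r) :
    Integrable fun w : Fin n → ℂ => Real.exp (-(r * ∑ j, lam j * ‖w j‖ ^ 2)) := by
  -- The Bochner integral of a non-integrable function is `0` by convention, so a nonzero value
  -- proves integrability.
  refine Integrable.of_integral_ne_zero ?_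
  rw [integral_exp_neg_sum hlam hr]
  have := Finset.prod_pos fun j (_ : j ∈ Finset.univ) => hlam j
  positivity

theorem integral_pow_mul_exp_neg (m : ℕ) {b : ℝ} (hb : 0 < b) :
    ∫ r in Set.Ioi (0 : ℝ), r ^ m * Real.exp (-(b * r)) = m.factorial * (b ^ (m + 1))⁻¹ := by
  have h := Real.integral_rpow_mul_exp_neg_mul_Ioi (a := m + 1) (by positivity) hb
  rw [Real.Gamma_nat_eq_factorial, add_sub_cancel_right] at h
  simp only [Real.rpow_natCast] at h
  rw [h, mul_comm, ← Nat.cast_add_one, Real.rpow_natCast, one_div, inv_pow]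

/-- Writing `n! A^{-(n+1)}` as `∫ r^n e^{-Ar} dr` and exchanging integrals leaves a Gaussian in `w`,
whose factor `r^{-n}` cancels `r^n`. -/
theorem integral_inv_pow_one_add (hlam : ∀ j, 0 < lam j) :
    ∫ w : Fin n → ℂ, ((1 + ∑ j, lam j * ‖w j‖ ^ 2) ^ (n + 1))⁻¹ =
      Real.pi ^ n / (n.factorial * ∏ j, lam j) := by
  have hprod := Finset.prod_pos fun j (_ : j ∈ Finset.univ) => hlam j
  have hpos : ∀ w : Fin n → ℂ, 0 < 1 + ∑ j, lam j * ‖w j‖ ^ 2 := fun w =>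
    add_pos_of_pos_of_nonneg one_pos
      (Finset.sum_nonneg fun j _ => mul_nonneg (hlam j).le (sq_nonneg _))
  have hexp : ∀ (r : ℝ) (w : Fin n → ℂ),
      r ^ n * Real.exp (-((1 + ∑ j, lam j * ‖w j‖ ^ 2) * r)) =
      r ^ n * Real.exp (-r) * Real.exp (-(r * ∑ j, lam j * ‖w j‖ ^ 2)) := by
    intro r w
    rw [mul_assoc, ← Real.exp_add]
    congr 2
    ring
  have hinner : ∀ r ∈ Set.Ioi (0 : ℝ),
      ∫ w : Fin n → ℂ, r ^ n * Real.exp (-((1 + ∑ j, lam j * ‖w j‖ ^ 2) * r)) =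
        (Real.pi ^ n / ∏ j, lam j) * Real.exp (-r) := by
    intro r hr
    have hr' : (0 : ℝ) < r := hr
    simp only [hexp]
    rw [integral_const_mul, integral_exp_neg_sum hlam hr']
    field_simp
  have hcont : Continuous fun p : (Fin n → ℂ) × ℝ =>
      p.2 ^ n * Real.exp (-((1 + ∑ j, lam j * ‖p.1 j‖ ^ 2) * p.2)) := by
    fun_prop
  have hint : Integrable (fun p : (Fin n → ℂ) × ℝ =>
      p.2 ^ n * Real.exp (-((1 + ∑ j, lam j * ‖p.1 j‖ ^ 2) * p.2)))
      ((volume : Measure (Fin n → ℂ)).prod (volume.restrict (Set.Ioi 0))) := by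
    rw [integrable_prod_iff' hcont.aestronglyMeasurable]
    constructor
    · refine (ae_restrict_iff' measurableSet_Ioi).2 (ae_of_all _ fun r hr => ?_)
      simp only [hexp]
      exact (integrable_exp_neg_sum hlam hr).const_mul _
    · have : IntegrableOn (fun r : ℝ => (Real.pi ^ n / ∏ j, lam j) * Real.exp (-r))
          (Set.Ioi 0) := (integrableOn_exp_neg_Ioi 0).const_mul _
      refine this.congr_fun (fun r hr => ?_) measurableSet_Ioi
      simp only
      rw [← hinner r hr]
      refine integral_congr_ae (ae_of_all _ fun w => ?_)
      have hr' : (0 : ℝ) < r := hr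
      exact (Real.norm_of_nonneg (by positivity)).symm
  have e : ∀ w : Fin n → ℂ, ((1 + ∑ j, lam j * ‖w j‖ ^ 2) ^ (n + 1))⁻¹ =
      (n.factorial : ℝ)⁻¹ * ∫ r in Set.Ioi (0 : ℝ),
        r ^ n * Real.exp (-((1 + ∑ j, lam j * ‖w j‖ ^ 2) * r)) := by
    intro w
    rw [integral_pow_mul_exp_neg n (hpos w), inv_mul_cancel_left₀ (by positivity)]
  simp only [e]
  rw [integral_const_mul, integral_integral_swap hint, setIntegral_congr_fun measurableSet_Ioi hinner,
    integral_const_mul, integral_exp_neg_Ioi_zero]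
  field_simp

/-- With `a = 1 + ∑ λ_j |w_j|²`, integrating out `t` gives `4π (2a)^{-(n+1)}`; the density `2ⁿ` of
`heisVol n` compensates all but one factor of the power of two. -/
theorem integral_poissonKernel (hlam : ∀ j, 0 < lam j) :
    ∫ v, poissonKernel lam 1 v ∂(heisVol n) =
      ((2 * Real.pi ^ (n + 1) / (n.factorial * ∏ j, lam j) : ℝ) : ℂ) := by
  have hint : Integrable (poissonKernel lam 1) (volume : Measure (Heis n)) := by
    have := integrable_poissonKernel hlam (ε := 1) one_pos
    have h2 := this.smul_measure_nnreal (c := ((2 : ℝ≥0) ^ n)⁻¹)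
    rwa [smul_smul, inv_mul_cancel₀ (by positivity), one_smul] at h2
  rw [integral_smul_nnreal_measure, heis_volume_eq, integral_prod _ hint]
  have e : ∀ w : Fin n → ℂ, ∫ t : ℝ, poissonKernel lam 1 (w, t) =
      ((4 * Real.pi * (2 ^ (n + 1))⁻¹ * ((1 + ∑ j, lam j * ‖w j‖ ^ 2) ^ (n + 1))⁻¹ : ℝ) : ℂ) := by
    intro w
    have hpos : 0 < 1 + ∑ j, lam j * ‖w j‖ ^ 2 := add_pos_of_pos_of_nonneg one_pos
      (Finset.sum_nonneg fun j _ => mul_nonneg (hlam j).le (sq_nonneg _))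
    have h := integral_inv_pow_mul_inv hpos n
    have e2 : ∀ t : ℝ, poissonKernel lam 1 (w, t) = 2 *
        ((((1 + ∑ j, lam j * ‖w j‖ ^ 2 : ℝ) : ℂ) - Complex.I * t) ^ (n + 1))⁻¹ *
          (((1 + ∑ j, lam j * ‖w j‖ ^ 2 : ℝ) : ℂ) + Complex.I * t)⁻¹ := by
      intro t
      have e3 : conj (gauge lam (w, t)) + ((1 : ℝ) : ℂ) =
          ((1 + ∑ j, lam j * ‖w j‖ ^ 2 : ℝ) : ℂ) - Complex.I * t := by
        simp only [gauge, map_add, map_mul, Complex.conj_ofReal, Complex.conj_I,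
          Complex.ofReal_add]
        ring
      have e4 : gauge lam (w, t) + ((1 : ℝ) : ℂ) =
          ((1 + ∑ j, lam j * ‖w j‖ ^ 2 : ℝ) : ℂ) + Complex.I * t := by
        simp only [gauge, Complex.ofReal_add]
        ring
      rw [poissonKernel, e3, e4, Complex.ofReal_one, mul_one]
    simp only [e2, mul_assoc]
    rw [integral_const_mul, h, mul_pow, mul_inv]
    push_cast
    ring
  simp only [e]
  rw [integral_complex_ofReal, integral_const_mul, integral_inv_pow_one_add hlam, NNReal.smul_def,
    Complex.real_smul, ← Complex.ofReal_mul]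
  congr 1
  push_cast
  field_simp
  ring

/-! ### Weak convergence of the approximate identity -/

theorem integral_mul_poissonKernel_dil (f : Heis n → ℂ) (y : Heis n) {r : ℝ} (hr : 0 < r) :
    ∫ v, f (mul lam y v) * poissonKernel lam (r ^ 2) v ∂(heisVol n) =
      ∫ v, f (mul lam y (dil r v)) * poissonKernel lam 1 v ∂(heisVol n) := by
  have h := integral_dil hr fun v => f (mul lam y v) * poissonKernel lam (r ^ 2) v
  simp only [poissonKernel_dil lam hr, mul_smul_comm, integral_smul] at h
  exact (smul_right_injective ℂ (by positivity : (r ^ (2 * n + 2))⁻¹ ≠ 0) h).symm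

theorem memLp_mul_right {f : Heis n → ℂ} (hf : MemLp f 2 (heisVol n)) (v : Heis n) :
    MemLp (fun y => f (mul lam y v)) 2 (heisVol n) :=
  hf.comp_measurePreserving (measurePreserving_mul_right lam v)

/-- Follows from `ab ≤ a² + b²` and right invariance. The bound does not depend on `v`, so it serves
both Fubini and dominated convergence. -/
theorem integral_norm_mul_le {f ψ : Heis n → ℂ} (hf : MemLp f 2 (heisVol n))
    (hψ : MemLp ψ 2 (heisVol n)) (v : Heis n) :
    ∫ y, ‖ψ y * f (mul lam y v)‖ ∂(heisVol n) ≤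
      ∫ y, ‖ψ y‖ ^ 2 ∂(heisVol n) + ∫ y, ‖f y‖ ^ 2 ∂(heisVol n) := by
  have hsq : ∀ {g : Heis n → ℂ}, MemLp g 2 (heisVol n) →
      Integrable (fun y => ‖g y‖ ^ 2) (heisVol n) := fun hg =>
    (memLp_two_iff_integrable_sq_norm hg.1).1 hg
  have hfv : MemLp (fun y => f (mul lam y v)) 2 (heisVol n) := memLp_mul_right hf v
  have e : ∫ y, ‖f y‖ ^ 2 ∂(heisVol n) = ∫ y, ‖f (mul lam y v)‖ ^ 2 ∂(heisVol n) :=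
    ((measurePreserving_mul_right lam v).integral_comp
      (mulRightHomeo lam v).measurableEmbedding fun y => ‖f y‖ ^ 2).symm
  rw [e, ← integral_add (hsq hψ) (hsq hfv)]
  refine integral_mono (hψ.integrable_mul hfv).norm ((hsq hψ).add (hsq hfv)) fun y => ?_
  simp only [norm_mul]
  nlinarith [sq_nonneg (‖ψ y‖ - ‖f (mul lam y v)‖), sq_nonneg ‖ψ y‖,
    sq_nonneg ‖f (mul lam y v)‖]

/-- Right invariance moves the translation onto `ψ`, whose translates vary continuously with
supports in a fixed compact set; local integrability of `f` then suffices. -/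
theorem tendsto_integral_translate (lam : Fin n → ℝ) {f ψ : Heis n → ℂ}
    (hf : MemLp f 2 (heisVol n)) (hψ : IsTest ψ) (v : Heis n) :
    Tendsto (fun r : ℝ => ∫ y, ψ y * f (mul lam y (dil r v)) ∂(heisVol n)) (𝓝[>] 0)
      (𝓝 (∫ y, ψ y * f y ∂(heisVol n))) := by
  have e : ∀ r : ℝ, ∫ y, ψ y * f (mul lam y (dil r v)) ∂(heisVol n) =
      ∫ y, f y * ψ (mul lam y (-dil r v)) ∂(heisVol n) := by
    intro r
    rw [← integral_mul_right lam (dil r v) fun y => f y * ψ (mul lam y (-dil r v))]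
    simp only [mul_mul_neg, mul_comm]
  simp only [e]
  -- This compact set contains the supports of all translates of `ψ` with `r ∈ [0, 1]`.
  let k : Set (Heis n) := (fun p : ℝ × Heis n => mul lam p.2 (dil p.1 v)) ''
    (Set.Icc 0 1 ×ˢ tsupport ψ)
  have hdil : Continuous fun r : ℝ => dil r v := continuous_dil.comp (Continuous.prodMk_left v)
  have hk : IsCompact k := by
    exact (isCompact_Icc.prod hψ.2).image ((continuous_mul lam).comp
      (continuous_snd.prodMk (hdil.comp continuous_fst)))
  have hcont := continuousOn_integral_bilinear_of_locally_integrable_of_compact_support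
    (μ := heisVol n) (ContinuousLinearMap.mul ℂ ℂ)
    (f := fun (r : ℝ) (y : Heis n) => ψ (mul lam y (-dil r v))) (s := Set.Icc 0 1) (g := f) hk
    ?_ ?_ ((hf.locallyIntegrable (by norm_num)).integrableOn_isCompact hk)
  · have h0 := (hcont 0 (by simp)).tendsto.mono_left
      (nhdsWithin_le_of_mem (Icc_mem_nhdsGT (zero_lt_one (α := ℝ))))
    have hmul0 : ∀ y : Heis n, mul lam y (-dil 0 v) = y := by
      intro y
      refine Prod.ext ?_ ?_ <;> simp [mul, dil]
    simpa [hmul0, mul_comm] using h0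
  · exact (hψ.1.continuous.comp ((continuous_mul lam).comp
      (continuous_snd.prodMk (hdil.comp continuous_fst).neg))).continuousOn
  · intro r y hr hy
    refine image_eq_zero_of_notMem_tsupport fun hmem => hy ?_
    refine ⟨(r, mul lam y (-dil r v)), ⟨hr, hmem⟩, ?_⟩
    simpa using mul_mul_neg lam y (-dil r v)

/-- Strong measurability of `f` itself, not only almost everywhere, makes its composition with `(y,
v) ↦ y · dil r v` measurable with no discussion of null sets. -/
theorem integrable_prod_poissonKernel (hlam : ∀ j, 0 < lam j) {f ψ : Heis n → ℂ}
    (hfm : StronglyMeasurable f) (hf : MemLp f 2 (heisVol n)) (hψ : IsTest ψ) (r : ℝ) :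
    Integrable (fun p : Heis n × Heis n =>
      ψ p.1 * f (mul lam p.1 (dil r p.2)) * poissonKernel lam 1 p.2)
      ((heisVol n).prod (heisVol n)) := by
  have hc : Continuous fun p : Heis n × Heis n => mul lam p.1 (dil r p.2) :=
    (continuous_mul lam).comp (continuous_fst.prodMk
      (continuous_dil.comp (continuous_const.prodMk continuous_snd)))
  have hP := continuous_poissonKernel hlam (ε := 1) one_pos
  have hm : StronglyMeasurable fun p : Heis n × Heis n =>
      ψ p.1 * f (mul lam p.1 (dil r p.2)) * poissonKernel lam 1 p.2 :=
    ((hψ.1.continuous.comp continuous_fst).stronglyMeasurable.mul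
      (hfm.comp_measurable hc.measurable)).mul (hP.comp continuous_snd).stronglyMeasurable
  rw [integrable_prod_iff' hm.aestronglyMeasurable]
  refine ⟨ae_of_all _ fun v => ?_, ?_⟩
  · have h : Integrable (fun y => ψ y * f (mul lam y (dil r v))) (heisVol n) :=
      hψ.memLp.integrable_mul (memLp_mul_right hf (dil r v))
    exact h.mul_const (poissonKernel lam 1 v)
  · refine ((integrable_poissonKernel hlam (ε := 1) one_pos).norm.const_mul
      (∫ y, ‖ψ y‖ ^ 2 ∂(heisVol n) + ∫ y, ‖f y‖ ^ 2 ∂(heisVol n))).mono'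
      (hm.norm.integral_prod_left' (μ := heisVol n)).aestronglyMeasurable (ae_of_all _ fun v => ?_)
    rw [Real.norm_of_nonneg (integral_nonneg fun _ => norm_nonneg _)]
    simp only [norm_mul _ (poissonKernel lam 1 v), integral_mul_const]
    gcongr
    exact integral_norm_mul_le hf hψ.memLp (dil r v)

/-- With `ε = r²`, dilating `v` moves the parameter from the kernel onto `f`. Integrating in `y`
first leaves a translation, weakly continuous for each `v`, against a fixed integrable kernel. -/
theorem tendsto_integral_poissonKernel (hlam : ∀ j, 0 < lam j) {f ψ : Heis n → ℂ}
    (hfm : StronglyMeasurable f) (hf : MemLp f 2 (heisVol n)) (hψ : IsTest ψ) :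
    Tendsto (fun r : ℝ => ∫ y, ψ y *
        ∫ v, f (mul lam y v) * poissonKernel lam (r ^ 2) v ∂(heisVol n) ∂(heisVol n)) (𝓝[>] 0)
      (𝓝 ((∫ y, ψ y * f y ∂(heisVol n)) * ∫ v, poissonKernel lam 1 v ∂(heisVol n))) := by
  have e : ∀ r : ℝ, 0 < r → ∫ y, ψ y *
        ∫ v, f (mul lam y v) * poissonKernel lam (r ^ 2) v ∂(heisVol n) ∂(heisVol n) =
      ∫ v, (∫ y, ψ y * f (mul lam y (dil r v)) ∂(heisVol n)) * poissonKernel lam 1 v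
        ∂(heisVol n) := by
    intro r hr
    simp only [integral_mul_poissonKernel_dil f _ hr, ← integral_const_mul, ← integral_mul_const,
      ← mul_assoc]
    exact integral_integral_swap (integrable_prod_poissonKernel hlam hfm hf hψ r)
  rw [← integral_const_mul]
  refine Tendsto.congr' (f₁ := fun r => ∫ v, (∫ y, ψ y * f (mul lam y (dil r v)) ∂(heisVol n)) *
    poissonKernel lam 1 v ∂(heisVol n)) ?_ ?_
  · filter_upwards [self_mem_nhdsWithin] with r hr using (e r hr).symm
  · refine tendsto_integral_filter_of_dominated_convergence
      (fun v => (∫ y, ‖ψ y‖ ^ 2 ∂(heisVol n) + ∫ y, ‖f y‖ ^ 2 ∂(heisVol n)) *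
        ‖poissonKernel lam 1 v‖) (Eventually.of_forall fun r => ?_)
      (Eventually.of_forall fun r => ae_of_all _ fun v => ?_)
      ((integrable_poissonKernel hlam (ε := 1) one_pos).norm.const_mul _)
      (ae_of_all _ fun v => (tendsto_integral_translate lam hf hψ v).mul_const _)
    · simpa only [integral_mul_const] using
        (integrable_prod_poissonKernel hlam hfm hf hψ r).integral_prod_right.aestronglyMeasurable
    · rw [norm_mul]
      gcongr
      exact (norm_integral_le_integral_norm _).trans (integral_norm_mul_le hf hψ.memLp (dil r v))

/-! ### The Szegő projection of a test function -/

theorem ae_eq_of_forall_integral_test {g h : Heis n → ℂ} (hg : LocallyIntegrable g (heisVol n))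
    (hh : LocallyIntegrable h (heisVol n))
    (H : ∀ ψ : Heis n → ℂ, IsTest ψ →
      ∫ y, ψ y * g y ∂(heisVol n) = ∫ y, ψ y * h y ∂(heisVol n)) : g =ᵐ[heisVol n] h := by
  have h0 : ∀ᵐ x ∂(heisVol n), (g - h) x = 0 := by
    refine ae_eq_zero_of_integral_contDiff_smul_eq_zero (hg.sub hh) fun χ hχ hχ' => ?_
    have ht : IsTest (fun x => (χ x : ℂ)) :=
      ⟨Complex.ofRealCLM.contDiff.comp hχ, hχ'.comp_left (g := fun r : ℝ => (r : ℂ)) (by simp)⟩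
    have i1 := hg.integrable_smul_left_of_hasCompactSupport hχ.continuous hχ'
    have i2 := hh.integrable_smul_left_of_hasCompactSupport hχ.continuous hχ'
    simp only [Pi.sub_apply, smul_sub]
    rw [integral_sub i1 i2, sub_eq_zero]
    simpa only [Complex.real_smul] using H _ ht
  filter_upwards [h0] with x hx
  exact sub_eq_zero.1 hx

theorem regularizedIntegral_phaseMinus (hlam : ∀ j, 0 < lam j) (ε : ℝ) (u : Heis n → ℂ)
    (x : Heis n) : regularizedIntegral (phaseMinus lam) ε u x =
      ∫ y, szegoKernel lam ε x y * u y ∂(heisVol n) := by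
  simp only [regularizedIntegral, phaseMinus_eq_polar hlam, szegoKernel, one_div]

theorem exists_limit_regularizedIntegral (hn : 1 ≤ n) (hlam : ∀ j, 0 < lam j) {φ : Heis n → ℂ}
    (hφ : IsTest φ) : ∃ g : Heis n → ℂ,
      (∀ x, Tendsto (fun ε : ℝ => regularizedIntegral (phaseMinus lam) ε φ x) (𝓝[>] 0)
        (𝓝 (g x))) ∧
      (((2 * Real.pi ^ (n + 1) / (n.factorial * ∏ j, lam j) : ℝ) : ℂ) •
        szegoProjection lam) (hφ.memLp.toLp φ) =ᵐ[heisVol n] g := by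
  obtain ⟨H, hH, hHε⟩ := exists_continuous_extension hlam hφ
  refine ⟨fun x => H (0, x), fun x => ?_, ?_⟩
  · have h1 : Tendsto (fun ε : ℝ => H (ε, x)) (𝓝[>] 0) (𝓝 (H (0, x))) :=
      ((hH.comp (Continuous.prodMk_left x)).tendsto 0).mono_left nhdsWithin_le_nhds
    refine h1.congr' ?_
    filter_upwards [self_mem_nhdsWithin] with ε hε
    rw [regularizedIntegral_phaseMinus hlam, hHε ε hε x]
  · set f := szegoProjection lam (hφ.memLp.toLp φ)
    set M : ℂ := ((2 * Real.pi ^ (n + 1) / (n.factorial * ∏ j, lam j) : ℝ) : ℂ) with hM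
    refine (Lp.coeFn_smul M f).trans ?_
    have hf := Lp.memLp f
    refine ae_eq_of_forall_integral_test
      ((hf.const_smul M).locallyIntegrable (by norm_num))
      (hH.comp (Continuous.prodMk_right 0)).locallyIntegrable fun ψ hψ => ?_
    have h1 := tendsto_integral_poissonKernel hlam (Lp.stronglyMeasurable f) hf hψ
    rw [integral_poissonKernel hlam, ← hM] at h1
    have h2 : Continuous fun r : ℝ => ∫ y, ψ y * H (r ^ 2, y) ∂(heisVol n) := by
      rw [← continuousOn_univ]
      refine continuousOn_integral_of_compact_support (k := tsupport ψ) hψ.2 ?_ ?_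
      · exact (((hψ.1.continuous.comp continuous_snd).mul (hH.comp
          (((continuous_fst.pow 2)).prodMk continuous_snd)))).continuousOn
      · intro r y _ hy
        rw [image_eq_zero_of_notMem_tsupport hy, zero_mul]
    have h3 : Tendsto (fun r : ℝ => ∫ y, ψ y * H (r ^ 2, y) ∂(heisVol n)) (𝓝[>] 0)
        (𝓝 (∫ y, ψ y * H (0, y) ∂(heisVol n))) := by
      have := (h2.tendsto 0).mono_left (nhdsWithin_le_nhds (s := Set.Ioi 0))
      simpa using this
    -- The same regularized integrals at `ε = r²`, tested against `ψ`, now seen through the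
    -- approximate identity; comparing with `h3` identifies the pointwise limit.
    have h4 : Tendsto (fun r : ℝ => ∫ y, ψ y * H (r ^ 2, y) ∂(heisVol n)) (𝓝[>] 0)
        (𝓝 ((∫ y, ψ y * f y ∂(heisVol n)) * M)) := by
      refine h1.congr' ?_
      filter_upwards [self_mem_nhdsWithin] with r hr
      have hr2 : 0 < r ^ 2 := pow_pos hr 2
      simp only [← hHε _ hr2, integral_szegoKernel_eq hn hlam hφ hr2]
      rfl
    rw [← tendsto_nhds_unique h4 h3, ← integral_mul_const]
    refine integral_congr_ae (ae_of_all _ fun y => ?_)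
    simp only [Pi.smul_apply, smul_eq_mul]
    ring

/-- Pointwise limits are unique, so both operators agree on test functions, which are dense in `L²`.
-/
theorem IsL2Extension.eq {φ : Heis n → Heis n → ℂ} {I J : L2Fun n →L[ℂ] L2Fun n}
    (hI : IsL2Extension φ I) (hJ : IsL2Extension φ J) : I = J := by
  refine ContinuousLinearMap.ext fun f => ?_
  refine congrFun (Continuous.ext_on (Lp.dense_hasCompactSupport_contDiff (F := ℂ)
    (μ := heisVol n) (p := 2) (by norm_num)) I.continuous J.continuous ?_) f
  rintro f ⟨u, hfu, hu1, hu2⟩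
  have hu : IsTest u := ⟨hu2, hu1⟩
  have e : f = hu.memLp.toLp u := Lp.ext (hfu.trans hu.memLp.coeFn_toLp.symm)
  obtain ⟨g, hg, hIg⟩ := hI u hu
  obtain ⟨g', hg', hJg⟩ := hJ u hu
  have : g = g' := funext fun x => tendsto_nhds_unique (hg x) (hg' x)
  subst this
  rw [e]
  exact Lp.ext (hIg.trans hJg.symm)

end Heisenberg

end

theorem theorem1p2 (n : ℕ) (hn : 1 ≤ n) (lam : Fin n → ℝ) (hlam : ∀ j, 0 < lam j) :
    (∃! I : Heisenberg.L2Fun n →L[ℂ] Heisenberg.L2Fun n,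
        Heisenberg.IsL2Extension (Heisenberg.phaseMinus lam) I) ∧
      ∀ I : Heisenberg.L2Fun n →L[ℂ] Heisenberg.L2Fun n,
        Heisenberg.IsL2Extension (Heisenberg.phaseMinus lam) I →
          Heisenberg.szegoProjection lam =
            (((∏ j, |lam j|) / (2 * Real.pi ^ (n + 1)) * (n.factorial : ℝ) : ℝ) : ℂ) • I := by
  have hS : Heisenberg.IsL2Extension (Heisenberg.phaseMinus lam)
      (((2 * Real.pi ^ (n + 1) / (n.factorial * ∏ j, lam j) : ℝ) : ℂ) •
        Heisenberg.szegoProjection lam) := fun φ hφ =>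
    Heisenberg.exists_limit_regularizedIntegral hn hlam hφ
  refine ⟨⟨_, hS, fun J hJ => hJ.eq hS⟩, fun I hI => ?_⟩
  have hprod := Finset.prod_pos fun j (_ : j ∈ Finset.univ) => hlam j
  have habs : ∀ j, |lam j| = lam j := fun j => abs_of_pos (hlam j)
  simp only [habs]
  rw [hI.eq hS, smul_smul, ← Complex.ofReal_mul]
  have : (∏ j, lam j) / (2 * Real.pi ^ (n + 1)) * (n.factorial : ℝ) *
      (2 * Real.pi ^ (n + 1) / (n.factorial * ∏ j, lam j)) = 1 := by
    field_simp
  rw [this, Complex.ofReal_one, one_smul]
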